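/- **Setting.** Fix the number of classes $K\ge 2$. Let $(Y^i,\mathbf X^i)$, $i=1,\dots,n$, be i.i.d. with $\Pr(Y^i=k)=\pi_k$ and $\mathbf X^i\mid Y^i=k\sim N(\mu_k,\Sigma)$ in $\mathbb R^p$, $k=1,\dots,K$, where $\Sigma$ is positive definite. Let $\theta_k=\theta_k^{\mathrm{Bayes}}=\Sigma^{-1}\mu_k-\Sigma^{-1}\mu_1$ for $k=2,\dots,K$, let $\mathcal D=\{j:\theta_{kj}\neq 0\text{ for some }k\}$, assumed nonempty, and $d=|\mathcal D|$. With $n_k$, $\hat\mu_k$ the size and the sample mean of class $k$ and $\hat\Sigma=\frac1{n-K}\sum_{k}\sum_{Y^i=k}(\mathbf X^i-\hat\mu_k)(\mathbf X^i-\hat\mu_k)^{T}$, let $$(\hat\theta_2,\dots,\hat\theta_K)=\arg\min_{\theta_2,\dots,\theta_K}\sum_{k=2}^K\Big\{\tfrac12\theta_k^{T}\hat\Sigma\theta_k-(\hat\mu_k-\hat\mu_1)^{T}\theta_k\Big\}+\lambda\sum_{j=1}^p\Big(\sum_{k=2}^K\theta_{kj}^2\Big)^{1/2},$$ and $\hat{\mathcal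 D}=\{j:\hat\theta_{kj}\ne0\text{ for some }k\}$. For a vector, $\|\cdot\|_\infty$ is the maximum norm; for a matrix, $\|\cdot\|_\infty$ is the maximal absolute row sum and $\|\cdot\|_1$ the maximal absolute column sum. Put $\varphi=\max\{\|\Sigma_{\mathcal D^c,\mathcal D}\|_\infty,\|\Sigma_{\mathcal D,\mathcal D}^{-1}\|_\infty\}$, $\Delta=\max\{\|(\mu_1,\dots,\mu_K)\|_1,\|(\theta_2,\dots,\theta_K)\|_1\}$, $\eta^*=\|\Sigma_{\mathcal D^c,\mathcal D}\Sigma_{\mathcal D,\mathcal D}^{-1}\|_\infty$, $\theta_{\min}=\min_{\theta_{kj}\ne0}|\theta_{kj}|$, $\theta_{\max}=\max|\theta_{kj}|$, $t_{kj}=\theta_{kj}/(\sum_{l}\theta_{lj}^2)^{1/2}$ for $j\in\mathcal D$, and $$\kappa=\max_{j\in\mathcal D^c}\Big\{\sum_{k=2}^K\big(\Sigma_{j,\mathcal D}\Sigma_{\mathcal D,\mathcal D}^{-1}t_{k,\mathcal D}\big)^2\Big\}^{1/2}$$ ($\kappa=0$ if $\mathcal D^c=\emptyset$). Let $\varphi_0,\Delta_0,\eta_0,s_0$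 and $c_1>0$, $C_1$ be constants and consider models with $\varphi\le\varphi_0$, $\Delta\le\Delta_0$, $\eta^*\le\eta_0$, $\max_j\Sigma_{jj}\le s_0$ and * (C0) $\kappa\le\kappa_0$, where $\kappa_0<1$ is a constant; * (C1) $c_1/K\le\pi_k\le C_1/K$ for all $k$, and $\theta_{\max}/\theta_{\min}<C_1$. **Theorem.** 1. Let $\theta_0>0$. There is a constant $M>0$ depending only on $K,c_1,C_1,\varphi_0,\Delta_0,\eta_0,s_0,\theta_0$, and, for every $\kappa_0<1$, there are constants $C,c>0$ depending only on these quantities and $\kappa_0$, such that for all $n$, $p$, all such models with $\theta_{\min}\ge\theta_0$, all $\lambda<\min\{\frac{\theta_{\min}}{8\varphi},M(1-\kappa)\}$ and all $0<\epsilon<\min\{\frac1{2\varphi},\frac{\lambda}{1+\varphi\Delta}\}$, there is an event of probability greater than $$1-Cpd\exp\Big(-cn\frac{\epsilon^2}{Kd^2}\Big)-CK\exp\Big(-c\frac n{K^2}\Big)-Cp(K-1)\exp\Big(-cn\frac{\epsilon^2}{K}\Big)$$ on which the minimizer $\hat\theta$ exists and is unique, $\hat{\mathcal D}=\mathcal D$,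 and $\|\hat\theta_k-\theta_k^{\mathrm{Bayes}}\|_\infty\le4\varphi\lambda$ for $k=2,\dots,K$. 2. Consider a sequence of such models ($\kappa_0$ and the other constants, including $K$, fixed; no fixed lower bound on $\theta_{\min}$ is required) and tuning parameters $\lambda>0$ with (C2) $n,p\to\infty$ and $\frac{d^2\log(pd)}n\to0$, and (C3) $\theta_{\min}\gg\{\frac{d^2\log(pd)}n\}^{1/2}$. If $\{\frac{d^2\log(pd)}n\}^{1/2}\ll\lambda\ll\theta_{\min}$, then with probability tending to 1 the minimizer $\hat\theta$ exists and is unique, $\hat{\mathcal D}=\mathcal D$, and $\|\hat\theta_k-\theta_k^{\mathrm{Bayes}}\|_\infty\le4\varphi\lambda$ for $k=2,\dots,K$. -/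

import Mathlib

open MeasureTheory ProbabilityTheory Filter Topology Matrix
open scoped Asymptotics

noncomputable section

namespace MSDA

/-! ### Norms -/

/-- The maximum norm of a vector. -/
def vecSup {m : ℕ} (v : Fin m → ℝ) : ℝ := ⨆ j, |v j|

/-- The maximal absolute row sum `max_i ∑_j |ω_ij|` of a matrix
(it is `0` if there are no rows). -/
def matInf {m n : Type*} [Fintype n] (A : Matrix m n ℝ) : ℝ := ⨆ i, ∑ j, |A i j|

/-- For a family of vectors `v_1, …, v_r`, regarded as the columns of a matrix, the maximal
absolute column sum `max_k ∑_j |v_kj|`. -/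
def colOne {r p : ℕ} (v : Fin r → Fin p → ℝ) : ℝ := ⨆ k, ∑ j, |v k j|

/-- The Euclidean norm of the group `θ_{·j}`, i.e. `(∑_k θ_kj ^ 2) ^ (1/2)`. -/
def groupNorm {q p : ℕ} (θ : Fin q → Fin p → ℝ) (j : Fin p) : ℝ := √(∑ k, θ k j ^ 2)

/-- The set of variables `j` such that `θ_kj ≠ 0` for some `k`. -/
def activeSet {q p : ℕ} (θ : Fin q → Fin p → ℝ) : Finset (Fin p) :=
  open Classical in Finset.univ.filter fun j => ∃ k, θ k j ≠ 0

/-! ### The model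

There are `K = q + 1` classes, indexed by `Fin (q + 1)`. Class `0` is the baseline class, and the
discriminant direction with index `k : Fin q` compares class `k.succ` with class `0`. -/

/-- The parameters of a linear discriminant analysis model with `q + 1` classes and
`p` predictors: class probabilities, class means and the common covariance matrix. -/
structure Model (q p : ℕ) where
  prior : Fin (q + 1) → ℝ
  mean : Fin (q + 1) → EuclideanSpace ℝ (Fin p)
  cov : Matrix (Fin p) (Fin p) ℝ
  prior_nonneg : ∀ k, 0 ≤ prior k
  prior_sum : ∑ k, prior k = 1
  cov_posDef : cov.PosDef

namespace Model

variable {q p : ℕ} (L : Model q p)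

/-- The joint law of `(Y, X)`: `Y = k` with probability `π_k`, and `X` given `Y = k` is normal
with mean `μ_k` and covariance `Σ`. -/
def law : Measure (Fin (q + 1) × EuclideanSpace ℝ (Fin p)) :=
  ∑ k, ENNReal.ofReal (L.prior k) •
    (Measure.dirac k).prod (multivariateGaussian (L.mean k) L.cov)

/-- `β_k = Σ⁻¹ μ_k`. -/
def beta (k : Fin (q + 1)) : Fin p → ℝ := L.cov⁻¹ *ᵥ (L.mean k).ofLp

/-- The Bayes discriminant directions: `β` of a non-baseline class minus `β` of the baseline. -/
def theta (k : Fin q) : Fin p → ℝ := L.beta k.succ - L.beta 0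

/-- The set `D` of the variables that contribute to the Bayes rule. -/
def D : Finset (Fin p) := activeSet L.theta

/-- The cardinality `d` of `D`. -/
def d : ℕ := L.D.card

/-- `Σ_{D,D}`. -/
def covDD : Matrix {j // j ∈ L.D} {j // j ∈ L.D} ℝ :=
  L.cov.submatrix Subtype.val Subtype.val

/-- `Σ_{Dᶜ,D}`. -/
def covCD : Matrix {j // j ∉ L.D} {j // j ∈ L.D} ℝ :=
  L.cov.submatrix Subtype.val Subtype.val

/-- `φ = max(‖Σ_{Dᶜ,D}‖_∞, ‖Σ_{D,D}⁻¹‖_∞)`. -/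
def phi : ℝ := max (matInf L.covCD) (matInf L.covDD⁻¹)

/-- `Δ = max(‖μ‖_1, ‖θ‖_1)`, where `μ` and `θ` are the matrices with columns `μ_k` and `θ_k`. -/
def Delta : ℝ := max (colOne fun k => (L.mean k).ofLp) (colOne L.theta)

/-- `η* = ‖Σ_{Dᶜ,D} Σ_{D,D}⁻¹‖_∞`. -/
def etaStar : ℝ := matInf (L.covCD * L.covDD⁻¹)

/-- The smallest absolute value of a nonzero coefficient `θ_kj`. -/
def thetaMin : ℝ := sInf {x | ∃ k j, L.theta k j ≠ 0 ∧ x = |L.theta k j|}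

/-- The largest absolute value of a coefficient `θ_kj`. -/
def thetaMax : ℝ := sSup {x | ∃ k j, x = |L.theta k j|}

/-- The vector `t_{k,D}`, where `t_kj = θ_kj / ‖θ_{·j}‖` is the subgradient of the group penalty
`∑_j ‖θ_{·j}‖` at the Bayes directions (`θ_{·j} ≠ 0` for `j ∈ D`, so that it is unique there). -/
def subgrad (k : Fin q) : {j // j ∈ L.D} → ℝ := fun j => L.theta k j / groupNorm L.theta j

/-- `κ = max_{j ∉ D} {∑_k (Σ_{j,D} Σ_{D,D}⁻¹ t_{k,D})²}^{1/2}`, the irrepresentability constant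
(it is `0` if every variable is in `D`). -/
def kappa : ℝ :=
  ⨆ j : {j // j ∉ L.D}, √(∑ k, (((L.covCD * L.covDD⁻¹) *ᵥ L.subgrad k) j) ^ 2)

/-- The class probabilities are of order `1 / K`, and `θ_max / θ_min < C₁`. -/
def Balanced (c₁ C₁ : ℝ) : Prop :=
  (∀ k, c₁ / ((q + 1 : ℕ) : ℝ) ≤ L.prior k ∧ L.prior k ≤ C₁ / ((q + 1 : ℕ) : ℝ)) ∧
    L.thetaMax / L.thetaMin < C₁

/-- `Z i = (Y^i, X^i)`, `i = 1, …, n`, is an i.i.d. sample from the model. -/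
structure IsSample {n : ℕ} {Ω : Type*} [MeasurableSpace Ω] (P : Measure Ω)
    (Z : Fin n → Ω → Fin (q + 1) × EuclideanSpace ℝ (Fin p)) : Prop where
  measurable : ∀ i, Measurable (Z i)
  map_eq : ∀ i, P.map (Z i) = L.law
  indep : iIndepFun Z P

end Model

/-! ### The estimator -/

section Estimator

variable {q p n : ℕ} (z : Fin n → Fin (q + 1) × EuclideanSpace ℝ (Fin p))

/-- The indices of the observations in class `k`. -/
def classIdx (k : Fin (q + 1)) : Finset (Fin n) := Finset.univ.filter fun i => (z i).1 = k

/-- The sample mean of class `k`. -/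
def sampleMean (k : Fin (q + 1)) : Fin p → ℝ :=
  ((classIdx z k).card : ℝ)⁻¹ • ∑ i ∈ classIdx z k, (z i).2.ofLp

/-- The pooled sample covariance matrix, with denominator `n - K`. -/
def sampleCov : Matrix (Fin p) (Fin p) ℝ :=
  ((n : ℝ) - ((q + 1 : ℕ) : ℝ))⁻¹ • ∑ k, ∑ i ∈ classIdx z k,
    vecMulVec ((z i).2.ofLp - sampleMean z k) ((z i).2.ofLp - sampleMean z k)

/-- The objective function of the group-lasso penalized multiclass sparse discriminant analysis. -/
def objective (lam : ℝ) (θ : Fin q → Fin p → ℝ) : ℝ :=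
  ∑ k, ((1 / 2) * (θ k ⬝ᵥ (sampleCov z *ᵥ θ k))
      - (sampleMean z k.succ - sampleMean z 0) ⬝ᵥ θ k)
    + lam * ∑ j, groupNorm θ j

/-- `θ` is a solution of the penalized problem. -/
def IsEstimate (lam : ℝ) (θ : Fin q → Fin p → ℝ) : Prop :=
  ∀ θ', objective z lam θ ≤ objective z lam θ'

/-- The penalized problem has exactly one solution `θ̂`; it selects exactly the variables in `D`,
and `‖θ̂_k - θ_k‖_∞ ≤ 4 φ λ` for all `k`. -/
def Success (L : Model q p) (lam : ℝ) : Prop :=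
  ∃ θ : Fin q → Fin p → ℝ,
    IsEstimate z lam θ ∧ (∀ θ', IsEstimate z lam θ' → θ' = θ) ∧
    activeSet θ = L.D ∧ ∀ k, vecSup (θ k - L.theta k) ≤ 4 * L.phi * lam

end Estimator

end MSDA

end

/-!
The argument separates a deterministic statement about the penalized quadratic from a
concentration statement about the sample moments.

*Deterministic part* (`Model.groupLasso_support_recovery`). Write `S` for the sample covariance
matrix and `δ_k` for the differences of sample means, and suppose that their entries are accurate
to `e / d` and `e`, with `e` a small multiple of `λ`. Since `e φ ≤ 1 / 2`, the bound
`‖x‖_∞ ≤ φ ‖Σ_{D,D} x‖_∞` survives, with `2 φ` in place of `φ`, when `Σ` is replaced by `S`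
(`Model.abs_le_two_mul_phi_mul`). Minimizing over the vectors supported on `D` gives an oracle
solution `θ̂`; the gradient of its quadratic part is at most `λ` in absolute value on `D`, so that
`|θ̂_kj - θ_kj| ≤ 2 φ (λ + λ) = 4 φ λ < θ_min` and `θ̂` has support exactly `D`. For `j ∉ D`, the
row `a = Σ_{j,D} Σ_{D,D}⁻¹` turns the gradient at `j` into a sampling error, of order `e`, minus
`λ ∑_l a_l t̂_kl`. As `t̂ - t` is of order `φ λ / θ_min`, the Euclidean norm over `k` of the
gradient is at most `λ (κ + 2 (1 - κ) / 3) < λ`. Strict dual feasibility then makes `θ̂` the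
unique global minimizer, although `S` itself may be singular (`groupLasso_unique_min_of_kkt`).

*Probabilistic part* (`Model.exists_event_moments_close`). In terms of the within-class deviations
`X - μ_Y`, the sample moments are functions of three families of i.i.d. sums: products of two
deviations, deviations restricted to one class, and class indicators. All of them are
sub-exponential with constants that depend only on the variances, so that a Chernoff bound and a
union bound over `O(p d)` sums give accuracy `e / d` up to probability
`C p d exp(-c n e² / d²)`. This is already the first term of the bound; the other two are used only
to make the inequality strict.

In the first part of the theorem `e` is a small multiple of `ε`, in the second a small multiple
of `λ`; the multiple depends on `κ₀`, which is why the constants of the bound do and `M` does not.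
-/

namespace MSDA

/-! ### Euclidean norms of groups of coefficients -/

lemma sqrt_sum_sq_add_le {q : ℕ} (u v : Fin q → ℝ) :
    √(∑ k, (u k + v k) ^ 2) ≤ √(∑ k, u k ^ 2) + √(∑ k, v k ^ 2) := by
  have h := norm_add_le (WithLp.toLp 2 u : EuclideanSpace ℝ (Fin q)) (WithLp.toLp 2 v)
  simpa [EuclideanSpace.norm_eq] using h

lemma abs_le_sqrt_sum_sq {q : ℕ} (u : Fin q → ℝ) (k : Fin q) : |u k| ≤ √(∑ l, u l ^ 2) :=
  Real.abs_le_sqrt (Finset.single_le_sum (f := fun l => u l ^ 2) (fun _ _ => sq_nonneg _)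
    (Finset.mem_univ k))

lemma sqrt_sum_sq_le {q : ℕ} (u : Fin q → ℝ) {b : ℝ} (hb : 0 ≤ b) (h : ∀ k, |u k| ≤ b) :
    √(∑ k, u k ^ 2) ≤ q * b := by
  refine Real.sqrt_le_iff.2 ⟨by positivity, ?_⟩
  have h1 : ∑ k, u k ^ 2 ≤ ∑ _k : Fin q, b ^ 2 :=
    Finset.sum_le_sum fun k _ => sq_le_sq' (abs_le.1 (h k)).1 (abs_le.1 (h k)).2
  rw [Finset.sum_const, Finset.card_univ, Fintype.card_fin, nsmul_eq_mul] at h1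
  rcases Nat.eq_zero_or_pos q with h0 | h0
  · subst h0; simp
  · have : (1 : ℝ) ≤ q := by exact_mod_cast h0
    have h2 : (q : ℝ) * b ^ 2 ≤ (q * q) * b ^ 2 := by
      gcongr; nlinarith
    nlinarith

lemma abs_sum_mul_le {q : ℕ} (u v : Fin q → ℝ) :
    |∑ k, u k * v k| ≤ √(∑ k, u k ^ 2) * √(∑ k, v k ^ 2) := by
  rw [← Real.sqrt_mul (Finset.sum_nonneg fun _ _ => sq_nonneg _)]
  exact Real.abs_le_sqrt (Finset.sum_mul_sq_le_sq_mul_sq _ _ _)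

/-- The normalization `v ↦ v / ‖v‖` is Lipschitz at `v ≠ 0` with constant `2 / ‖v‖`. -/
lemma abs_normalize_sub_le {q : ℕ} (u v : Fin q → ℝ) {b : ℝ}
    (hu : 0 < √(∑ k, u k ^ 2)) (hv : 0 < √(∑ k, v k ^ 2))
    (h : √(∑ k, (u k - v k) ^ 2) ≤ b) (k : Fin q) :
    |u k / √(∑ k, u k ^ 2) - v k / √(∑ k, v k ^ 2)| ≤ 2 * b / √(∑ k, v k ^ 2) := by
  have h1 := (abs_le_sqrt_sum_sq (fun k => u k - v k) k).trans h
  have h2 := abs_le_sqrt_sum_sq u k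
  have h3 : |√(∑ k, v k ^ 2) - √(∑ k, u k ^ 2)| ≤ b := by
    have ha := sqrt_sum_sq_add_le v (fun k => u k - v k)
    have hb := sqrt_sum_sq_add_le u (fun k => v k - u k)
    have hc : ∑ k, (v k - u k) ^ 2 = ∑ k, (u k - v k) ^ 2 :=
      Finset.sum_congr rfl fun k _ => by ring
    simp only [add_sub_cancel] at ha hb
    rw [hc] at hb
    exact abs_le.2 ⟨by linarith, by linarith⟩
  set a := √(∑ k, u k ^ 2)
  set c := √(∑ k, v k ^ 2)
  have e : u k / a - v k / c = (u k - v k) / c + u k / a * ((c - a) / c) := by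
    field_simp; ring
  have h4 : |u k / a| ≤ 1 := by
    rw [abs_div, abs_of_pos hu]; exact div_le_one_of_le₀ h2 hu.le
  rw [e]
  calc _ ≤ |(u k - v k) / c| + |u k / a * ((c - a) / c)| := abs_add_le _ _
    _ ≤ b / c + 1 * (b / c) := by
        rw [abs_mul, abs_div, abs_div (c - a), abs_of_pos hv]
        gcongr
    _ = _ := by ring

lemma groupNorm_nonneg {q p : ℕ} (θ : Fin q → Fin p → ℝ) (j : Fin p) : 0 ≤ groupNorm θ j :=
  Real.sqrt_nonneg _

lemma abs_le_groupNorm {q p : ℕ} (θ : Fin q → Fin p → ℝ) (k : Fin q) (j : Fin p) :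
    |θ k j| ≤ groupNorm θ j :=
  abs_le_sqrt_sum_sq (fun k => θ k j) k

lemma groupNorm_zero {q p : ℕ} (j : Fin p) : groupNorm (0 : Fin q → Fin p → ℝ) j = 0 := by
  simp [groupNorm]

/-- Subgradient inequality for the Euclidean norm. -/
lemma groupNorm_sub_ge {q p : ℕ} (θ θ' : Fin q → Fin p → ℝ) (j : Fin p) (h : 0 < groupNorm θ j) :
    ∑ k, θ k j / groupNorm θ j * (θ' k j - θ k j) ≤ groupNorm θ' j - groupNorm θ j := by
  have h1 := (le_abs_self _).trans (abs_sum_mul_le (fun k => θ k j) (fun k => θ' k j))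
  have h2 : groupNorm θ j ^ 2 = ∑ k, θ k j ^ 2 :=
    Real.sq_sqrt (Finset.sum_nonneg fun _ _ => sq_nonneg _)
  have h3 : ∑ k, θ k j / groupNorm θ j * (θ' k j - θ k j)
      = (∑ k, θ k j * θ' k j - groupNorm θ j ^ 2) / groupNorm θ j := by
    rw [h2, ← Finset.sum_sub_distrib, Finset.sum_div]
    exact Finset.sum_congr rfl fun k _ => by ring
  rw [h3, div_le_iff₀ h]
  change _ ≤ groupNorm θ j * groupNorm θ' j at h1
  linarith

/-! ### The penalized quadratic problem -/

/-- The group-lasso penalized quadratic `∑_k (θ_kᵀ S θ_k / 2 - δ_kᵀ θ_k) + λ ∑_j ‖θ_{·j}‖`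
for an arbitrary matrix `S` and arbitrary vectors `δ_k`. -/
noncomputable def groupLasso {q p : ℕ} (S : Matrix (Fin p) (Fin p) ℝ)
    (δ : Fin q → Fin p → ℝ) (lam : ℝ) (θ : Fin q → Fin p → ℝ) : ℝ :=
  ∑ k, ((1 / 2) * (θ k ⬝ᵥ (S *ᵥ θ k)) - δ k ⬝ᵥ θ k) + lam * ∑ j, groupNorm θ j

variable {q p : ℕ} {S : Matrix (Fin p) (Fin p) ℝ} {δ : Fin q → Fin p → ℝ} {lam : ℝ}

lemma dotProduct_mulVec_nonneg_of_posSemidef (hS : S.PosSemidef) (x : Fin p → ℝ) :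
    0 ≤ x ⬝ᵥ (S *ᵥ x) := by
  simpa using hS.dotProduct_mulVec_nonneg x

lemma dotProduct_mulVec_symm (hS : S.PosSemidef) (x y : Fin p → ℝ) :
    x ⬝ᵥ (S *ᵥ y) = y ⬝ᵥ (S *ᵥ x) := by
  have h : Sᵀ = S := by simpa using hS.isHermitian.eq
  rw [dotProduct_mulVec, ← mulVec_transpose, h, dotProduct_comm]

/-- Exact second-order expansion of the penalized quadratic. -/
lemma groupLasso_sub (hS : S.PosSemidef) (θ θ' : Fin q → Fin p → ℝ) :
    groupLasso S δ lam θ' - groupLasso S δ lam θ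
      = (1 / 2) * ∑ k, (θ' k - θ k) ⬝ᵥ (S *ᵥ (θ' k - θ k))
        + ∑ j, (∑ k, ((S *ᵥ θ k) j - δ k j) * (θ' k j - θ k j)
          + lam * (groupNorm θ' j - groupNorm θ j)) := by
  have e1 : ∀ k, (1 / 2) * (θ' k ⬝ᵥ (S *ᵥ θ' k)) - δ k ⬝ᵥ θ' k
      = ((1 / 2) * (θ k ⬝ᵥ (S *ᵥ θ k)) - δ k ⬝ᵥ θ k)
        + ((1 / 2) * ((θ' k - θ k) ⬝ᵥ (S *ᵥ (θ' k - θ k)))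
        + (S *ᵥ θ k - δ k) ⬝ᵥ (θ' k - θ k)) := by
    intro k
    have := dotProduct_mulVec_symm hS (θ k) (θ' k)
    simp only [mulVec_sub, dotProduct_sub, sub_dotProduct]
    rw [dotProduct_comm (S *ᵥ θ k) (θ' k), dotProduct_comm (S *ᵥ θ k) (θ k)]
    linarith
  have e2 : ∑ j, ∑ k, ((S *ᵥ θ k) j - δ k j) * (θ' k j - θ k j)
      = ∑ k, (S *ᵥ θ k - δ k) ⬝ᵥ (θ' k - θ k) := by
    rw [Finset.sum_comm]; rfl
  unfold groupLasso
  rw [Finset.sum_congr rfl fun k _ => e1 k, Finset.sum_add_distrib, Finset.sum_add_distrib,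
    Finset.sum_add_distrib, e2, ← Finset.mul_sum, ← Finset.mul_sum, Finset.sum_sub_distrib,
    Finset.sum_sub_distrib]
  ring

/-- Sufficiency of the Karush-Kuhn-Tucker conditions. Strict dual feasibility off `D`, together
with the injectivity of `S_{D,D}`, makes the minimizer unique even if `S` is singular. -/
lemma groupLasso_unique_min_of_kkt (hS : S.PosSemidef) (hlam : 0 < lam) (D : Finset (Fin p))
    (θ : Fin q → Fin p → ℝ) (hoff : ∀ k, ∀ j ∉ D, θ k j = 0)
    (hinj : ∀ x : Fin p → ℝ, (∀ j ∉ D, x j = 0) → (∀ j ∈ D, (S *ᵥ x) j = 0) → x = 0)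
    (hpos : ∀ j ∈ D, 0 < groupNorm θ j)
    (hon : ∀ j ∈ D, ∀ k, (S *ᵥ θ k) j - δ k j = -lam * (θ k j / groupNorm θ j))
    (hdual : ∀ j ∉ D, √(∑ k, ((S *ᵥ θ k) j - δ k j) ^ 2) < lam) :
    (∀ θ', groupLasso S δ lam θ ≤ groupLasso S δ lam θ') ∧
      ∀ θ', groupLasso S δ lam θ' ≤ groupLasso S δ lam θ → θ' = θ := by
  have hin : ∀ θ' : Fin q → Fin p → ℝ, ∀ j ∈ D,
      0 ≤ ∑ k, ((S *ᵥ θ k) j - δ k j) * (θ' k j - θ k j)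
          + lam * (groupNorm θ' j - groupNorm θ j) := by
    intro θ' j hj
    have h := mul_le_mul_of_nonneg_left (groupNorm_sub_ge θ θ' j (hpos j hj)) hlam.le
    rw [Finset.mul_sum] at h
    have : ∑ k, ((S *ᵥ θ k) j - δ k j) * (θ' k j - θ k j)
        = -∑ k, lam * (θ k j / groupNorm θ j * (θ' k j - θ k j)) := by
      rw [← Finset.sum_neg_distrib]
      exact Finset.sum_congr rfl fun k _ => by rw [hon j hj k]; ring
    linarith
  have hout : ∀ θ' : Fin q → Fin p → ℝ, ∀ j ∉ D,
      (lam - √(∑ k, ((S *ᵥ θ k) j - δ k j) ^ 2)) * groupNorm θ' j ≤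
        ∑ k, ((S *ᵥ θ k) j - δ k j) * (θ' k j - θ k j)
          + lam * (groupNorm θ' j - groupNorm θ j) := by
    intro θ' j hj
    have h0 : groupNorm θ j = 0 := by simp [groupNorm, hoff _ j hj]
    have h := (abs_le.1 (abs_sum_mul_le (fun k => (S *ᵥ θ k) j - δ k j) (fun k => θ' k j))).1
    change -(_ * groupNorm θ' j) ≤ _ at h
    simp only [hoff _ j hj, sub_zero, h0]
    linarith
  have hterm : ∀ θ' : Fin q → Fin p → ℝ, ∀ j,
      0 ≤ ∑ k, ((S *ᵥ θ k) j - δ k j) * (θ' k j - θ k j)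
          + lam * (groupNorm θ' j - groupNorm θ j) := by
    intro θ' j
    by_cases hj : j ∈ D
    · exact hin θ' j hj
    · exact (mul_nonneg (sub_nonneg.2 (hdual j hj).le) (groupNorm_nonneg _ _)).trans
        (hout θ' j hj)
  have hquad : ∀ θ' : Fin q → Fin p → ℝ, ∀ k, 0 ≤ (θ' k - θ k) ⬝ᵥ (S *ᵥ (θ' k - θ k)) :=
    fun θ' k => dotProduct_mulVec_nonneg_of_posSemidef hS _
  refine ⟨fun θ' => ?_, fun θ' h => ?_⟩
  · have := groupLasso_sub (δ := δ) (lam := lam) hS θ θ'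
    have h1 := Finset.sum_nonneg fun k (_ : k ∈ Finset.univ) => hquad θ' k
    have h2 := Finset.sum_nonneg fun j (_ : j ∈ Finset.univ) => hterm θ' j
    linarith
  · have := groupLasso_sub (δ := δ) (lam := lam) hS θ θ'
    have h1 := Finset.sum_nonneg fun k (_ : k ∈ Finset.univ) => hquad θ' k
    have h2 := Finset.sum_nonneg fun j (_ : j ∈ Finset.univ) => hterm θ' j
    have h3 := (Finset.sum_eq_zero_iff_of_nonneg fun k _ => hquad θ' k).1 (le_antisymm
      (by linarith) h1)
    have h4 := (Finset.sum_eq_zero_iff_of_nonneg fun j _ => hterm θ' j).1 (le_antisymm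
      (by linarith) h2)
    have h5 : ∀ k, ∀ j ∉ D, θ' k j = 0 := by
      intro k j hj
      have ha := hout θ' j hj
      rw [h4 j (Finset.mem_univ j)] at ha
      have hb : groupNorm θ' j ≤ 0 := by
        by_contra! hc
        exact absurd ha (not_le.2 (mul_pos (sub_pos.2 (hdual j hj)) hc))
      exact abs_nonpos_iff.1 ((abs_le_groupNorm θ' k j).trans hb)
    funext k
    have h6 : S *ᵥ (θ' k - θ k) = 0 := by
      refine (hS.dotProduct_mulVec_zero_iff _).1 ?_
      simpa using h3 k (Finset.mem_univ k)
    have h7 := hinj (θ' k - θ k) (fun j hj => by simp [h5 k j hj, hoff k j hj])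
      (fun j _ => by rw [h6]; rfl)
    exact sub_eq_zero.1 h7

/-- The oracle problem, restricted to the coefficients in `D`, has a solution if `S_{D,D}` is
injective. -/
lemma exists_oracle_min (hS : S.PosSemidef) (hlam : 0 < lam) (D : Finset (Fin p))
    (hinj : ∀ x : Fin p → ℝ, (∀ j ∉ D, x j = 0) → (∀ j ∈ D, (S *ᵥ x) j = 0) → x = 0) :
    ∃ θ : Fin q → Fin p → ℝ, (∀ k, ∀ j ∉ D, θ k j = 0) ∧
      ∀ θ' : Fin q → Fin p → ℝ, (∀ k, ∀ j ∉ D, θ' k j = 0) →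
        groupLasso S δ lam θ ≤ groupLasso S δ lam θ' := by
  classical
  -- Solve `S_{D,D} y = δ_D` by completing `S_{D,D}` with the identity off `D`.
  have hsol : ∀ b : Fin p → ℝ, ∃ y : Fin p → ℝ, (∀ j ∉ D, y j = 0) ∧
      ∀ j ∈ D, (S *ᵥ y) j = b j := by
    intro b
    let R : (Fin p → ℝ) →ₗ[ℝ] (Fin p → ℝ) :=
      { toFun := fun x j => if j ∈ D then x j else 0
        map_add' := fun x y => by ext j; by_cases h : j ∈ D <;> simp [h]
        map_smul' := fun c x => by ext j; by_cases h : j ∈ D <;> simp [h] }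
    let T : (Fin p → ℝ) →ₗ[ℝ] (Fin p → ℝ) :=
      R ∘ₗ S.mulVecLin ∘ₗ R + (LinearMap.id - R)
    have hR : ∀ x j, R x j = if j ∈ D then x j else 0 := fun _ _ => rfl
    have hTon : ∀ x, ∀ j ∈ D, T x j = (S *ᵥ R x) j := by
      intro x j hj; simp [T, hR, hj]
    have hToff : ∀ x, ∀ j ∉ D, T x j = x j := by
      intro x j hj; simp [T, hR, hj]
    have hTinj : Function.Injective T := by
      refine (injective_iff_map_eq_zero T).2 fun x hx => ?_
      have h1 : R x = 0 := hinj _ (fun j hj => by simp [hR, hj]) fun j hj => by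
        rw [← hTon x j hj, hx]; rfl
      ext j
      by_cases hj : j ∈ D
      · have := congrFun h1 j; simpa [hR, hj] using this
      · rw [← hToff x j hj, hx]
    obtain ⟨x, hx⟩ := (LinearMap.injective_iff_surjective.1 hTinj) b
    exact ⟨R x, fun j hj => by simp [hR, hj], fun j hj => by rw [← hTon x j hj, hx]⟩
  choose y hyoff hyon using fun k => hsol (δ k)
  set V : Set (Fin q → Fin p → ℝ) := {θ | ∀ k, ∀ j ∉ D, θ k j = 0}
  set C : ℝ := (1 / 2) * ∑ k, y k ⬝ᵥ (S *ᵥ y k)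
  -- Completing the square shows that the quadratic part is bounded below, so that the penalty
  -- makes the objective coercive.
  have hlow : ∀ θ ∈ V, lam * ∑ j, groupNorm θ j - C ≤ groupLasso S δ lam θ := by
    intro θ hθ
    have hk : ∀ k, -((1 / 2) * (y k ⬝ᵥ (S *ᵥ y k))) ≤
        (1 / 2) * (θ k ⬝ᵥ (S *ᵥ θ k)) - δ k ⬝ᵥ θ k := by
      intro k
      have h1 : δ k ⬝ᵥ θ k = θ k ⬝ᵥ (S *ᵥ y k) := by
        rw [dotProduct_comm]
        refine Finset.sum_congr rfl fun j _ => ?_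
        by_cases hj : j ∈ D
        · rw [hyon k j hj]
        · simp [hθ k j hj]
      have h2 := dotProduct_mulVec_nonneg_of_posSemidef hS (θ k - y k)
      have h3 := dotProduct_mulVec_symm hS (θ k) (y k)
      simp only [mulVec_sub, dotProduct_sub, sub_dotProduct] at h2
      linarith
    have := Finset.sum_le_sum fun k (_ : k ∈ Finset.univ) => hk k
    rw [Finset.sum_neg_distrib, ← Finset.mul_sum] at this
    change -C ≤ _ at this
    unfold groupLasso
    linarith
  have hcont : Continuous (groupLasso S δ lam) := by
    unfold groupLasso groupNorm dotProduct mulVec dotProduct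
    fun_prop
  have hgcont : Continuous fun θ : Fin q → Fin p → ℝ => ∑ j, groupNorm θ j := by
    unfold groupNorm; fun_prop
  have hVclosed : IsClosed V := by
    have : V = ⋂ k, ⋂ j, ⋂ _ : j ∉ D, {θ : Fin q → Fin p → ℝ | θ k j = 0} := by
      ext θ; simp [V]
    rw [this]
    exact isClosed_iInter fun k => isClosed_iInter fun j => isClosed_iInter fun _ =>
      isClosed_eq (by fun_prop) continuous_const
  have hC : 0 ≤ C := mul_nonneg (by norm_num)
    (Finset.sum_nonneg fun k _ => dotProduct_mulVec_nonneg_of_posSemidef hS _)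
  set W : Set (Fin q → Fin p → ℝ) := V ∩ {θ | ∑ j, groupNorm θ j ≤ C / lam}
  have hWclosed : IsClosed W := hVclosed.inter (isClosed_le hgcont continuous_const)
  have hWcomp : IsCompact W := by
    refine (isCompact_closedBall (0 : Fin q → Fin p → ℝ) (C / lam)).of_isClosed_subset hWclosed ?_
    intro θ hθ
    have hr : 0 ≤ C / lam := by positivity
    rw [mem_closedBall_zero_iff, pi_norm_le_iff_of_nonneg hr]
    intro k
    rw [pi_norm_le_iff_of_nonneg hr]
    intro j
    exact (abs_le_groupNorm θ k j).trans ((Finset.single_le_sum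
      (f := fun j => groupNorm θ j) (fun _ _ => groupNorm_nonneg _ _) (Finset.mem_univ j)).trans
      hθ.2)
  have h0W : (0 : Fin q → Fin p → ℝ) ∈ W := by
    refine ⟨fun k j _ => rfl, ?_⟩
    simp only [Set.mem_ofPred_eq, groupNorm_zero, Finset.sum_const_zero]
    positivity
  obtain ⟨θ, hθ, hmin⟩ := hWcomp.exists_isMinOn ⟨0, h0W⟩ hcont.continuousOn
  refine ⟨θ, hθ.1, fun θ' hθ' => ?_⟩
  by_cases h : ∑ j, groupNorm θ' j ≤ C / lam
  · exact hmin ⟨hθ', h⟩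
  · have h1 := hlow θ' hθ'
    have h2 : groupLasso S δ lam θ ≤ groupLasso S δ lam 0 := hmin h0W
    have h3 : groupLasso S δ lam 0 = 0 := by simp [groupLasso, groupNorm_zero]
    push Not at h
    rw [div_lt_iff₀ hlam] at h
    linarith

/-- A quadratic `h a + h² c` that dominates `-b |h|` has slope at most `b` at the origin. -/
lemma abs_le_of_forall_quadratic {a b c : ℝ} (h : ∀ h : ℝ, 0 ≤ h * a + h ^ 2 * c + b * |h|) :
    |a| ≤ b := by
  have key : ∀ a' : ℝ, (∀ h : ℝ, 0 < h → 0 ≤ h * a' + h ^ 2 * c + b * h) → 0 ≤ a' + b := by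
    intro a' h'
    have h1 : Tendsto (fun h : ℝ => a' + h * c + b) (𝓝[>] 0) (𝓝 (a' + 0 * c + b)) :=
      ((by fun_prop : Continuous fun h : ℝ => a' + h * c + b).tendsto 0).mono_left
        nhdsWithin_le_nhds
    have h2 := ge_of_tendsto h1 (b := 0) (by
      filter_upwards [self_mem_nhdsWithin] with x hx
      have hx : 0 < x := hx
      have := h' x hx
      have e : x * a' + x ^ 2 * c + b * x = x * (a' + x * c + b) := by ring
      rw [e] at this
      exact nonneg_of_mul_nonneg_right this hx)
    simpa using h2
  have h1 := key a fun x hx => by simpa [abs_of_pos hx] using h x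
  have h2 := key (-a) fun x hx => by
    have := h (-x)
    rw [abs_neg, abs_of_pos hx] at this
    linarith
  exact abs_le.2 ⟨by linarith, by linarith⟩

/-- Moving the single coefficient `(k, j)` by `h` changes the penalized quadratic by a quadratic
in `h` plus the change of one group norm. -/
lemma groupLasso_single_sub (hS : S.PosSemidef) (θ : Fin q → Fin p → ℝ) (k : Fin q) (j : Fin p)
    (h : ℝ) :
    ∃ θ' : Fin q → Fin p → ℝ, (∀ k' j', j' ≠ j → θ' k' j' = θ k' j') ∧
      (∀ k', θ' k' j = θ k' j + if k' = k then h else 0) ∧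
      groupLasso S δ lam θ' - groupLasso S δ lam θ
        = h * ((S *ᵥ θ k) j - δ k j) + h ^ 2 * (S j j / 2)
          + lam * (groupNorm θ' j - groupNorm θ j) := by
  set θ' : Fin q → Fin p → ℝ := fun k' => θ k' + if k' = k then Pi.single j h else 0
  have hθ' : ∀ k', θ' k' - θ k' = if k' = k then Pi.single j h else 0 := fun k' => by simp [θ']
  have hθ'' : ∀ k' j', θ' k' j' - θ k' j'
      = if k' = k then (Pi.single j h : Fin p → ℝ) j' else 0 := by
    intro k' j'
    have := congrFun (hθ' k') j'
    by_cases hk : k' = k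
    · simpa [hk] using this
    · simpa [hk] using this
  have hne : ∀ k' j', j' ≠ j → θ' k' j' = θ k' j' := by
    intro k' j' hj
    have := hθ'' k' j'
    rw [Pi.single_eq_of_ne hj, ite_self] at this
    exact sub_eq_zero.1 this
  refine ⟨θ', hne, fun k' => ?_, ?_⟩
  · have := hθ'' k' j
    rw [Pi.single_eq_same] at this
    linarith
  rw [groupLasso_sub hS θ θ', Finset.sum_eq_single k, Finset.sum_eq_single j,
    Finset.sum_eq_single k]
  · rw [hθ' k, hθ'' k j]
    simp
    ring
  · intro k' _ hk; rw [hθ'' k' j]; simp [hk]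
  · simp
  · intro j' _ hj
    have : groupNorm θ' j' = groupNorm θ j' := by simp [groupNorm, hne _ j' hj]
    simp [this, hne _ j' hj]
  · simp
  · intro k' _ hk; rw [hθ' k']; simp [hk]
  · simp

/-- Stationarity of a solution of the oracle problem: the gradient of the quadratic part is
bounded by `λ` on `D`, and equals `-λ θ_{·j} / ‖θ_{·j}‖` on the nonzero groups. -/
lemma oracle_stationary (hS : S.PosSemidef) (hlam : 0 < lam) (D : Finset (Fin p))
    (θ : Fin q → Fin p → ℝ) (hoff : ∀ k, ∀ j ∉ D, θ k j = 0)
    (hmin : ∀ θ' : Fin q → Fin p → ℝ, (∀ k, ∀ j ∉ D, θ' k j = 0) →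
        groupLasso S δ lam θ ≤ groupLasso S δ lam θ') (k : Fin q) (j : Fin p) (hj : j ∈ D) :
    |(S *ᵥ θ k) j - δ k j| ≤ lam ∧
      (0 < groupNorm θ j → (S *ᵥ θ k) j - δ k j = -lam * (θ k j / groupNorm θ j)) := by
  have main : ∀ h : ℝ, ∃ θ' : Fin q → Fin p → ℝ,
      (∀ k', θ' k' j = θ k' j + if k' = k then h else 0) ∧
      0 ≤ h * ((S *ᵥ θ k) j - δ k j) + h ^ 2 * (S j j / 2)
          + lam * (groupNorm θ' j - groupNorm θ j) := by
    intro h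
    obtain ⟨θ', h1, h2, h3⟩ := groupLasso_single_sub (δ := δ) (lam := lam) hS θ k j h
    refine ⟨θ', h2, ?_⟩
    have := hmin θ' fun k' j' hj' => by
      rw [h1 k' j' (fun e => hj' (e ▸ hj)), hoff k' j' hj']
    linarith
  constructor
  · refine abs_le_of_forall_quadratic (c := S j j / 2) fun h => ?_
    obtain ⟨θ', h1, h2⟩ := main h
    have h3 : groupNorm θ' j ≤ groupNorm θ j + |h| := by
      have := sqrt_sum_sq_add_le (fun k' => θ k' j) (fun k' => if k' = k then h else 0)
      simp only [← h1, ite_pow, ne_eq, OfNat.ofNat_ne_zero, not_false_eq_true, zero_pow,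
        Finset.sum_ite_eq', Finset.mem_univ, if_true, Real.sqrt_sq_eq_abs] at this
      exact this
    nlinarith
  · intro hpos
    set g := groupNorm θ j
    have : |(S *ᵥ θ k) j - δ k j + lam * (θ k j / g)| ≤ 0 := by
      refine abs_le_of_forall_quadratic (c := S j j / 2 + lam / (2 * g)) fun h => ?_
      obtain ⟨θ', h1, h2⟩ := main h
      have hg2 : g ^ 2 = ∑ k', θ k' j ^ 2 :=
        Real.sq_sqrt (Finset.sum_nonneg fun _ _ => sq_nonneg _)
      have hg' : groupNorm θ' j ^ 2 = g ^ 2 + 2 * h * θ k j + h ^ 2 := by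
        rw [hg2]
        have : groupNorm θ' j ^ 2 = ∑ k', θ' k' j ^ 2 :=
          Real.sq_sqrt (Finset.sum_nonneg fun _ _ => sq_nonneg _)
        rw [this]
        simp only [h1, add_sq, Finset.sum_add_distrib, mul_ite, mul_zero, ite_pow, ne_eq,
          OfNat.ofNat_ne_zero, not_false_eq_true, zero_pow, Finset.sum_ite_eq', Finset.mem_univ,
          if_true]
        ring
      -- `√(g² + s) ≤ g + s / (2 g)`.
      have h3 : groupNorm θ' j - g ≤ (2 * h * θ k j + h ^ 2) / (2 * g) := by
        rw [le_div_iff₀ (by positivity)]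
        nlinarith [sq_nonneg (groupNorm θ' j - g)]
      have h4 := mul_le_mul_of_nonneg_left h3 hlam.le
      have h5 : lam * ((2 * h * θ k j + h ^ 2) / (2 * g))
          = h * (lam * (θ k j / g)) + h ^ 2 * (lam / (2 * g)) := by
        field_simp
      nlinarith
    have := abs_nonpos_iff.1 this
    linarith

end MSDA

namespace MSDA

namespace Model

variable {q p : ℕ} (L : Model q p)

/-! ### Population quantities -/

lemma matInf_nonneg {m n : Type*} [Fintype n] (A : Matrix m n ℝ) : 0 ≤ matInf A :=
  Real.iSup_nonneg fun _ => Finset.sum_nonneg fun _ _ => abs_nonneg _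

lemma row_sum_le_matInf {m n : Type*} [Finite m] [Fintype n] (A : Matrix m n ℝ) (i : m) :
    ∑ j, |A i j| ≤ matInf A :=
  le_ciSup (f := fun i => ∑ j, |A i j|) (Set.finite_range _).bddAbove i

lemma abs_le_colOne {r p : ℕ} (v : Fin r → Fin p → ℝ) (k : Fin r) (j : Fin p) :
    |v k j| ≤ colOne v :=
  (Finset.single_le_sum (f := fun j => |v k j|) (fun _ _ => abs_nonneg _)
    (Finset.mem_univ j)).trans
    (le_ciSup (f := fun k => ∑ j, |v k j|) (Set.finite_range _).bddAbove k)

lemma colOne_nonneg {r p : ℕ} (v : Fin r → Fin p → ℝ) : 0 ≤ colOne v :=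
  Real.iSup_nonneg fun _ => Finset.sum_nonneg fun _ _ => abs_nonneg _

lemma phi_nonneg : 0 ≤ L.phi := (matInf_nonneg _).trans (le_max_left _ _)

lemma Delta_nonneg : 0 ≤ L.Delta := (colOne_nonneg _).trans (le_max_left _ _)

lemma etaStar_nonneg : 0 ≤ L.etaStar := matInf_nonneg _

lemma kappa_nonneg : 0 ≤ L.kappa := Real.iSup_nonneg fun _ => Real.sqrt_nonneg _

lemma thetaMin_nonneg : 0 ≤ L.thetaMin :=
  Real.sInf_nonneg fun _ ⟨_, _, _, h⟩ => h ▸ abs_nonneg _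

lemma abs_theta_le_Delta (k : Fin q) (j : Fin p) : |L.theta k j| ≤ L.Delta :=
  (abs_le_colOne L.theta k j).trans (le_max_right _ _)

lemma thetaMin_le {k : Fin q} {j : Fin p} (h : L.theta k j ≠ 0) : L.thetaMin ≤ |L.theta k j| :=
  csInf_le ⟨0, fun _ ⟨_, _, _, h⟩ => h ▸ abs_nonneg _⟩ ⟨k, j, h, rfl⟩

lemma mem_D {j : Fin p} : j ∈ L.D ↔ ∃ k, L.theta k j ≠ 0 := by
  classical
  simp [D, activeSet]

lemma theta_eq_zero {j : Fin p} (h : j ∉ L.D) (k : Fin q) : L.theta k j = 0 := by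
  by_contra h'
  exact h (L.mem_D.2 ⟨k, h'⟩)

lemma thetaMin_le_Delta (hD : L.D.Nonempty) : L.thetaMin ≤ L.Delta := by
  obtain ⟨j, hj⟩ := hD
  obtain ⟨k, hk⟩ := L.mem_D.1 hj
  exact (L.thetaMin_le hk).trans (L.abs_theta_le_Delta k j)

lemma cov_mulVec_theta (k : Fin q) :
    L.cov *ᵥ L.theta k = (L.mean k.succ).ofLp - (L.mean 0).ofLp := by
  have h : IsUnit L.cov.det := L.cov_posDef.det_pos.ne'.isUnit
  simp [theta, beta, mulVec_sub, mulVec_mulVec, mul_nonsing_inv _ h]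

lemma isUnit_det_covDD : IsUnit L.covDD.det :=
  (L.cov_posDef.submatrix Subtype.val_injective).det_pos.ne'.isUnit

/-- A sum over all variables of a function that vanishes off `D` is a sum over `D`. -/
lemma sum_eq_sum_subtype (f : Fin p → ℝ) (hf : ∀ j ∉ L.D, f j = 0) :
    ∑ j, f j = ∑ j : {j // j ∈ L.D}, f j := by
  rw [Finset.sum_coe_sort L.D f]
  exact (Finset.sum_subset (Finset.subset_univ _) fun j _ hj => hf j hj).symm

lemma cov_mulVec_apply (x : Fin p → ℝ) (hx : ∀ j ∉ L.D, x j = 0) (i : Fin p) :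
    (L.cov *ᵥ x) i = ∑ j : {j // j ∈ L.D}, L.cov i j * x j :=
  L.sum_eq_sum_subtype (fun j => L.cov i j * x j) fun j hj => by simp [hx j hj]

/-- The bound `‖x‖_∞ ≤ ‖Σ_{D,D}⁻¹‖_∞ ‖Σ_{D,D} x‖_∞`. -/
lemma abs_le_phi_mul (x : Fin p → ℝ) (hx : ∀ j ∉ L.D, x j = 0) {b : ℝ} (hb : 0 ≤ b)
    (h : ∀ j ∈ L.D, |(L.cov *ᵥ x) j| ≤ b) (j : Fin p) : |x j| ≤ L.phi * b := by
  by_cases hj : j ∈ L.D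
  · set y : {j // j ∈ L.D} → ℝ := fun j => x j
    have h1 : L.covDD⁻¹ *ᵥ (L.covDD *ᵥ y) = y := by
      rw [mulVec_mulVec, nonsing_inv_mul _ L.isUnit_det_covDD, one_mulVec]
    have h2 : ∀ l : {j // j ∈ L.D}, (L.covDD *ᵥ y) l = (L.cov *ᵥ x) l :=
      fun l => (L.cov_mulVec_apply x hx l).symm
    have h3 : x j = ∑ l, L.covDD⁻¹ ⟨j, hj⟩ l * (L.covDD *ᵥ y) l :=
      (congrFun h1 ⟨j, hj⟩).symm
    rw [h3]
    calc _ ≤ ∑ l, |L.covDD⁻¹ ⟨j, hj⟩ l * (L.covDD *ᵥ y) l| := Finset.abs_sum_le_sum_abs _ _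
      _ ≤ ∑ l, |L.covDD⁻¹ ⟨j, hj⟩ l| * b := by
          refine Finset.sum_le_sum fun l _ => ?_
          rw [abs_mul, h2]
          exact mul_le_mul_of_nonneg_left (h l l.2) (abs_nonneg _)
      _ ≤ _ := by
          rw [← Finset.sum_mul]
          exact mul_le_mul_of_nonneg_right
            ((row_sum_le_matInf _ _).trans (le_max_right _ _)) hb
  · rw [hx j hj, abs_zero]
    exact mul_nonneg L.phi_nonneg hb

/-- For `j ∉ D`, the row `a = Σ_{j,D} Σ_{D,D}⁻¹`, extended by zero, expresses the `j`-th entry of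
`Σ x` through its entries in `D`, for every `x` supported on `D`; its `ℓ₁` norm is at most `η*`
and it realizes the irrepresentability constant. -/
lemma exists_regression_row {j : Fin p} (hj : j ∉ L.D) :
    ∃ a : Fin p → ℝ, (∀ l ∉ L.D, a l = 0) ∧
      (∀ x : Fin p → ℝ, (∀ l ∉ L.D, x l = 0) → (L.cov *ᵥ x) j = ∑ l, a l * (L.cov *ᵥ x) l) ∧
      ∑ l, |a l| ≤ L.etaStar ∧
      √(∑ k, (∑ l, a l * (L.theta k l / groupNorm L.theta l)) ^ 2) ≤ L.kappa := by
  classical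
  set a : Fin p → ℝ := fun l => if h : l ∈ L.D then (L.covCD * L.covDD⁻¹) ⟨j, hj⟩ ⟨l, h⟩ else 0
  have ha0 : ∀ l ∉ L.D, a l = 0 := fun l hl => by simp [a, hl]
  have haD : ∀ l : {l // l ∈ L.D}, a l = (L.covCD * L.covDD⁻¹) ⟨j, hj⟩ l := fun l => by
    simp [a, l.2]
  refine ⟨a, ha0, fun x hx => ?_, ?_, ?_⟩
  · rw [L.sum_eq_sum_subtype (fun l => a l * (L.cov *ᵥ x) l) fun l hl => by simp [ha0 l hl]]
    have h1 : (L.covCD * L.covDD⁻¹) *ᵥ (L.covDD *ᵥ fun l => x l) = L.covCD *ᵥ fun l => x l := by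
      rw [mulVec_mulVec, Matrix.mul_assoc, nonsing_inv_mul _ L.isUnit_det_covDD, Matrix.mul_one]
    rw [L.cov_mulVec_apply x hx j]
    refine (congrFun h1 ⟨j, hj⟩).symm.trans ?_
    change ∑ l, (L.covCD * L.covDD⁻¹) ⟨j, hj⟩ l * (L.covDD *ᵥ fun l => x l) l = _
    refine Finset.sum_congr rfl fun l _ => ?_
    simp only [haD, L.cov_mulVec_apply x hx l]
    rfl
  · rw [L.sum_eq_sum_subtype (fun l => |a l|) fun l hl => by simp [ha0 l hl]]
    simp only [haD]
    exact row_sum_le_matInf (L.covCD * L.covDD⁻¹) ⟨j, hj⟩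
  · have h1 : ∀ k, ∑ l, a l * (L.theta k l / groupNorm L.theta l)
        = ((L.covCD * L.covDD⁻¹) *ᵥ L.subgrad k) ⟨j, hj⟩ := by
      intro k
      rw [L.sum_eq_sum_subtype (fun l => a l * (L.theta k l / groupNorm L.theta l))
        fun l hl => by simp [ha0 l hl]]
      simp only [haD]
      rfl
    simp only [h1]
    exact le_ciSup (f := fun j : {j // j ∉ L.D} =>
      √(∑ k, (((L.covCD * L.covDD⁻¹) *ᵥ L.subgrad k) j) ^ 2)) (Set.finite_range _).bddAbove _

/-! ### The deterministic part: from accurate moments to support recovery -/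

section Deterministic

variable {L} {S : Matrix (Fin p) (Fin p) ℝ} {e : ℝ}

lemma abs_mulVec_sub_le (he : 0 ≤ e) (hD : L.D.Nonempty)
    (hSe : ∀ i, ∀ j ∈ L.D, |S i j - L.cov i j| ≤ e / L.d)
    (x : Fin p → ℝ) (hx : ∀ j ∉ L.D, x j = 0) {b : ℝ} (hb : ∀ j, |x j| ≤ b) (i : Fin p) :
    |(S *ᵥ x) i - (L.cov *ᵥ x) i| ≤ e * b := by
  have hd : (0 : ℝ) < L.d := by exact_mod_cast hD.card_pos
  have h1 : (S *ᵥ x) i - (L.cov *ᵥ x) i = ∑ j ∈ L.D, (S i j - L.cov i j) * x j := by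
    have : (S *ᵥ x) i - (L.cov *ᵥ x) i = ∑ j, (S i j - L.cov i j) * x j := by
      simp only [mulVec, dotProduct, ← Finset.sum_sub_distrib, sub_mul]
    rw [this]
    exact (Finset.sum_subset (Finset.subset_univ _) fun j _ hj => by simp [hx j hj]).symm
  rw [h1]
  calc _ ≤ ∑ j ∈ L.D, |(S i j - L.cov i j) * x j| := Finset.abs_sum_le_sum_abs _ _
    _ ≤ ∑ _j ∈ L.D, e / L.d * b := by
        refine Finset.sum_le_sum fun j hj => ?_
        rw [abs_mul]
        exact mul_le_mul (hSe i j hj) (hb j) (abs_nonneg _) (by positivity)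
    _ = L.d * (e / L.d * b) := by rw [Finset.sum_const, nsmul_eq_mul]; rfl
    _ = _ := by field_simp

/-- The bound of `abs_le_phi_mul` survives a perturbation of `Σ`, at the price of a factor `2`. -/
lemma abs_le_two_mul_phi_mul (he : 0 ≤ e) (hD : L.D.Nonempty)
    (hSe : ∀ i, ∀ j ∈ L.D, |S i j - L.cov i j| ≤ e / L.d) (hphi : e * L.phi ≤ 1 / 2)
    (x : Fin p → ℝ) (hx : ∀ j ∉ L.D, x j = 0) {b : ℝ} (hb : 0 ≤ b)
    (h : ∀ j ∈ L.D, |(S *ᵥ x) j| ≤ b) (j : Fin p) : |x j| ≤ 2 * L.phi * b := by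
  have h1 : ∀ j ∈ L.D, |(L.cov *ᵥ x) j| ≤ b + e * ‖x‖ := by
    intro j hj
    have h2 := abs_mulVec_sub_le he hD hSe x hx (fun j => norm_le_pi_norm x j) j
    have h3 := h j hj
    rw [abs_le] at *
    constructor <;> linarith
  have h2 : ‖x‖ ≤ L.phi * (b + e * ‖x‖) :=
    (pi_norm_le_iff_of_nonneg (mul_nonneg L.phi_nonneg (by positivity))).2 fun j =>
      L.abs_le_phi_mul x hx (by positivity) h1 j
  have h3 : |x j| ≤ ‖x‖ := norm_le_pi_norm x j
  nlinarith [norm_nonneg x]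

/-- If the first two moments are estimated with accuracy `e` (`e / d` per entry of the covariance
matrix), with `e` small compared to `λ` and `λ` small compared to `θ_min`, then the penalized
problem has a unique solution, which selects `D` and is within `4 φ λ` of the Bayes directions. -/
theorem groupLasso_support_recovery {δ : Fin q → Fin p → ℝ} {lam : ℝ}
    (hS : S.PosSemidef) (he : 0 ≤ e) (hD : L.D.Nonempty)
    (hSe : ∀ i, ∀ j ∈ L.D, |S i j - L.cov i j| ≤ e / L.d)
    (hδ : ∀ k j, |δ k j - ((L.mean k.succ).ofLp j - (L.mean 0).ofLp j)| ≤ e)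
    (hlam : 0 < lam) (hphi : e * L.phi ≤ 1 / 2) (hDelta : e * (1 + L.Delta) ≤ lam)
    (hmin : 4 * L.phi * lam < L.thetaMin) (hkappa : L.kappa < 1)
    (hdual₁ : q * (e * ((1 + L.etaStar) * (1 + 2 * L.Delta))) ≤ lam * ((1 - L.kappa) / 3))
    (hdual₂ : 24 * q ^ 2 * L.etaStar * L.phi * lam ≤ (1 - L.kappa) * L.thetaMin) :
    ∃ θ : Fin q → Fin p → ℝ, (∀ θ', groupLasso S δ lam θ ≤ groupLasso S δ lam θ') ∧
      (∀ θ', (∀ θ'', groupLasso S δ lam θ' ≤ groupLasso S δ lam θ'') → θ' = θ) ∧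
      activeSet θ = L.D ∧ ∀ k, vecSup (θ k - L.theta k) ≤ 4 * L.phi * lam := by
  have hDel := L.Delta_nonneg
  have heta := L.etaStar_nonneg
  have hphi0 := L.phi_nonneg
  have hinj : ∀ x : Fin p → ℝ, (∀ j ∉ L.D, x j = 0) → (∀ j ∈ L.D, (S *ᵥ x) j = 0) → x = 0 := by
    intro x hx h
    ext j
    have := abs_le_two_mul_phi_mul he hD hSe hphi x hx le_rfl
      (fun j hj => by rw [h j hj, abs_zero]) j
    rw [mul_zero] at this
    exact abs_nonpos_iff.1 this
  obtain ⟨θ, hoff, hθmin⟩ := exists_oracle_min (δ := δ) hS hlam L.D hinj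
  have hstat := oracle_stationary hS hlam L.D θ hoff hθmin
  set D' : Fin q → Fin p → ℝ := fun k j => (L.mean k.succ).ofLp j - (L.mean 0).ofLp j with hD'
  have hcov : ∀ k j, (L.cov *ᵥ L.theta k) j = D' k j := fun k j => by
    rw [L.cov_mulVec_theta]; rfl
  have htheta0 : ∀ k, ∀ j ∉ L.D, L.theta k j = 0 := fun k j hj => L.theta_eq_zero hj k
  have hclose : ∀ k j, |θ k j - L.theta k j| ≤ 4 * L.phi * lam := by
    intro k j
    have h := abs_le_two_mul_phi_mul he hD hSe hphi (θ k - L.theta k)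
      (fun j hj => by simp [hoff k j hj, htheta0 k j hj]) (b := 2 * lam) (by positivity)
      (fun j hj => by
        have h1 := (hstat k j hj).1
        have h2 := abs_mulVec_sub_le he hD hSe (L.theta k) (htheta0 k) (L.abs_theta_le_Delta k) j
        have h3 := hδ k j
        rw [hcov] at h2
        change |δ k j - D' k j| ≤ e at h3
        have h4 : (S *ᵥ (θ k - L.theta k)) j = ((S *ᵥ θ k) j - δ k j) + (δ k j - D' k j)
            - ((S *ᵥ L.theta k) j - D' k j) := by
          rw [mulVec_sub, Pi.sub_apply]; ring
        rw [h4]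
        calc _ ≤ |(S *ᵥ θ k) j - δ k j| + |δ k j - D' k j| + |(S *ᵥ L.theta k) j - D' k j| :=
              (abs_sub _ _).trans (add_le_add_left (abs_add_le _ _) _)
          _ ≤ 2 * lam := by linarith) j
    calc |θ k j - L.theta k j| ≤ 2 * L.phi * (2 * lam) := h
      _ = _ := by ring
  have hgθ : ∀ j ∈ L.D, L.thetaMin ≤ groupNorm L.theta j := by
    intro j hj
    obtain ⟨k, hk⟩ := L.mem_D.1 hj
    exact (L.thetaMin_le hk).trans (abs_le_groupNorm _ _ _)
  have hmin0 : 0 < L.thetaMin := lt_of_le_of_lt (by positivity) hmin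
  have hne : ∀ j ∈ L.D, ∃ k, θ k j ≠ 0 := by
    intro j hj
    obtain ⟨k, hk⟩ := L.mem_D.1 hj
    refine ⟨k, fun h => ?_⟩
    have h1 := hclose k j
    rw [h, zero_sub, abs_neg] at h1
    linarith [L.thetaMin_le hk]
  have hpos : ∀ j ∈ L.D, 0 < groupNorm θ j := by
    intro j hj
    obtain ⟨k, hk⟩ := hne j hj
    exact (abs_pos.2 hk).trans_le (abs_le_groupNorm _ _ _)
  have hon : ∀ j ∈ L.D, ∀ k, (S *ᵥ θ k) j - δ k j = -lam * (θ k j / groupNorm θ j) :=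
    fun j hj k => (hstat k j hj).2 (hpos j hj)
  have hθle : ∀ k j, |θ k j| ≤ 2 * L.Delta := by
    intro k j
    have h1 := hclose k j
    have h2 := L.abs_theta_le_Delta k j
    have h3 := L.thetaMin_le_Delta hD
    rw [abs_le] at *
    constructor <;> linarith
  have hsub : ∀ j ∈ L.D, ∀ k, |θ k j / groupNorm θ j - L.theta k j / groupNorm L.theta j|
      ≤ 8 * q * L.phi * lam / L.thetaMin := by
    intro j hj k
    have h1 := abs_normalize_sub_le (fun k => θ k j) (fun k => L.theta k j) (hpos j hj)
      (hmin0.trans_le (hgθ j hj)) (sqrt_sum_sq_le _ (by positivity) fun k => hclose k j) k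
    refine h1.trans ?_
    have h2 : 2 * ((q : ℝ) * (4 * L.phi * lam)) = 8 * q * L.phi * lam := by ring
    rw [h2]
    exact div_le_div_of_nonneg_left (by positivity) hmin0 (hgθ j hj)
  have hdual : ∀ j ∉ L.D, √(∑ k, ((S *ᵥ θ k) j - δ k j) ^ 2) < lam := by
    intro j hj
    obtain ⟨a, ha0, hax, ha1, hak⟩ := L.exists_regression_row hj
    have hweight : ∀ (f : Fin p → ℝ) (b : ℝ), 0 ≤ b → (∀ l ∈ L.D, |f l| ≤ b) →
        |∑ l, a l * f l| ≤ L.etaStar * b := by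
      intro f b hb hf
      calc _ ≤ ∑ l, |a l * f l| := Finset.abs_sum_le_sum_abs _ _
        _ ≤ ∑ l, |a l| * b := by
            refine Finset.sum_le_sum fun l _ => ?_
            rw [abs_mul]
            by_cases hl : l ∈ L.D
            · exact mul_le_mul_of_nonneg_left (hf l hl) (abs_nonneg _)
            · simp [ha0 l hl]
        _ ≤ _ := by
            rw [← Finset.sum_mul]; exact mul_le_mul_of_nonneg_right ha1 hb
    -- Sampling error, change of the subgradient, and population subgradient.
    set u : Fin q → ℝ := fun k => (((S *ᵥ θ k) j - (L.cov *ᵥ θ k) j) - (δ k j - D' k j))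
      - ∑ l, a l * (((S *ᵥ θ k) l - (L.cov *ᵥ θ k) l) - (δ k l - D' k l))
    set v : Fin q → ℝ := fun k =>
      -lam * ∑ l, a l * (θ k l / groupNorm θ l - L.theta k l / groupNorm L.theta l)
    set w : Fin q → ℝ := fun k => -lam * ∑ l, a l * (L.theta k l / groupNorm L.theta l)
    have hdec : ∀ k, (S *ᵥ θ k) j - δ k j = (u k + v k) + w k := by
      intro k
      have h1 := hax (θ k) (hoff k)
      have h2 := hax (L.theta k) (htheta0 k)
      have h3 : ∑ l, a l * (S *ᵥ θ k) l
          = ∑ l, a l * δ k l - lam * ∑ l, a l * (θ k l / groupNorm θ l) := by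
        rw [Finset.mul_sum, ← Finset.sum_sub_distrib]
        refine Finset.sum_congr rfl fun l _ => ?_
        by_cases hl : l ∈ L.D
        · linear_combination a l * hon l hl k
        · simp [ha0 l hl]
      simp only [hcov] at h2
      simp only [u, v, w, mul_sub, Finset.sum_sub_distrib]
      linarith
    have hu0 : ∀ k l, |((S *ᵥ θ k) l - (L.cov *ᵥ θ k) l) - (δ k l - D' k l)|
        ≤ e * (1 + 2 * L.Delta) := by
      intro k l
      have h1 := abs_mulVec_sub_le he hD hSe (θ k) (hoff k) (hθle k) l
      have h2 : |δ k l - D' k l| ≤ e := hδ k l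
      refine (abs_sub _ _).trans ?_
      linarith
    have hu : √(∑ k, u k ^ 2) ≤ lam * ((1 - L.kappa) / 3) := by
      refine (sqrt_sum_sq_le u (b := e * ((1 + L.etaStar) * (1 + 2 * L.Delta)))
        (by positivity) fun k => ?_).trans hdual₁
      have h1 := hweight (fun l => ((S *ᵥ θ k) l - (L.cov *ᵥ θ k) l) - (δ k l - D' k l)) _
        (by positivity) fun l _ => hu0 k l
      have h2 := hu0 k j
      refine (abs_sub _ _).trans ?_
      linarith
    have hv : √(∑ k, v k ^ 2) ≤ lam * ((1 - L.kappa) / 3) := by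
      have h1 : ∀ k, |v k| ≤ lam * (L.etaStar * (8 * q * L.phi * lam / L.thetaMin)) := by
        intro k
        have h1 := hweight (fun l => θ k l / groupNorm θ l - L.theta k l / groupNorm L.theta l) _
          (by positivity) fun l hl => hsub l hl k
        simp only [v]
        rw [abs_mul, abs_neg, abs_of_pos hlam]
        exact mul_le_mul_of_nonneg_left h1 hlam.le
      refine (sqrt_sum_sq_le v (by positivity) h1).trans ?_
      have h2 : (q : ℝ) * (lam * (L.etaStar * (8 * q * L.phi * lam / L.thetaMin)))
          = lam * (24 * q ^ 2 * L.etaStar * L.phi * lam / L.thetaMin / 3) := by ring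
      rw [h2]
      have h3 : 24 * q ^ 2 * L.etaStar * L.phi * lam / L.thetaMin ≤ 1 - L.kappa :=
        (div_le_iff₀ hmin0).2 hdual₂
      gcongr
    have hw : √(∑ k, w k ^ 2) ≤ lam * L.kappa := by
      have h1 : ∑ k, w k ^ 2
          = lam ^ 2 * ∑ k, (∑ l, a l * (L.theta k l / groupNorm L.theta l)) ^ 2 := by
        rw [Finset.mul_sum]
        exact Finset.sum_congr rfl fun k _ => by simp only [w]; ring
      rw [h1, Real.sqrt_mul (sq_nonneg _), Real.sqrt_sq hlam.le]
      exact mul_le_mul_of_nonneg_left hak hlam.le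
    simp only [hdec]
    have h1 := sqrt_sum_sq_add_le (fun k => u k + v k) w
    have h2 := sqrt_sum_sq_add_le u v
    have h3 : 0 < lam * (1 - L.kappa) := mul_pos hlam (by linarith)
    linarith
  obtain ⟨hopt, huniq⟩ := groupLasso_unique_min_of_kkt hS hlam L.D θ hoff hinj hpos hon hdual
  refine ⟨θ, hopt, fun θ' h => huniq θ' (h θ), ?_, fun k => ?_⟩
  · classical
    ext j
    simp only [activeSet, Finset.mem_filter, Finset.mem_univ, true_and]
    refine ⟨fun ⟨k, hk⟩ => ?_, hne j⟩
    by_contra hj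
    exact hk (hoff k j hj)
  · exact Real.iSup_le (fun j => hclose k j) (by positivity)

end Deterministic

end Model

end MSDA

namespace MSDA

/-! ### Concentration of i.i.d. averages of sub-exponential variables -/

lemma exp_le_one_add_add_sq (x : ℝ) :
    Real.exp x ≤ 1 + x + x ^ 2 * Real.exp |x| := by
  have h1 : Real.exp x * (1 - x) ≤ 1 := by
    have := mul_le_mul_of_nonneg_left (Real.add_one_le_exp (-x)) (Real.exp_pos x).le
    rw [← Real.exp_add, add_neg_cancel, Real.exp_zero] at this
    linarith
  -- Hence `exp x - 1 - x ≤ x (exp x - 1)`.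
  rcases le_total 0 x with hx | hx
  · rw [abs_of_nonneg hx]
    nlinarith [mul_le_mul_of_nonneg_left h1 hx]
  · have h2 := Real.add_one_le_exp x
    have h3 : 1 ≤ Real.exp |x| := Real.one_le_exp (abs_nonneg _)
    have h4 := mul_le_mul_of_nonneg_left h3 (sq_nonneg x)
    nlinarith

lemma exp_mul_le {a s : ℝ} (ha : 0 < a) (hs : |s| ≤ a / 2) (x : ℝ) :
    Real.exp (s * x) ≤ 1 + s * x + 8 * (s / a) ^ 2 * Real.exp (a * |x|) := by
  have h1 := exp_le_one_add_add_sq (s * x)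
  have h2 : |s * x| ≤ a * |x| / 2 := by
    rw [abs_mul]; nlinarith [abs_nonneg x]
  have h3 : (a * |x| / 2) ^ 2 / 2 ≤ Real.exp (a * |x| / 2) := by
    have := Real.quadratic_le_exp_of_nonneg (x := a * |x| / 2) (by positivity)
    nlinarith [mul_nonneg ha.le (abs_nonneg x)]
  have h4 : (s * x) ^ 2 ≤ 8 * (s / a) ^ 2 * Real.exp (a * |x| / 2) := by
    have h5 : (s * x) ^ 2 = 8 * (s / a) ^ 2 * ((a * |x| / 2) ^ 2 / 2) := by
      have : |x| ^ 2 = x ^ 2 := sq_abs x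
      field_simp
      rw [this]; ring
    rw [h5]
    gcongr
  have h6 : Real.exp |s * x| ≤ Real.exp (a * |x| / 2) := Real.exp_le_exp.2 h2
  have h7 : (s * x) ^ 2 * Real.exp |s * x|
      ≤ 8 * (s / a) ^ 2 * Real.exp (a * |x| / 2) * Real.exp (a * |x| / 2) := by gcongr
  have h8 : Real.exp (a * |x|) = Real.exp (a * |x| / 2) * Real.exp (a * |x| / 2) := by
    rw [← Real.exp_add]; ring_nf
  rw [h8]
  linarith

/-- `f` is centered under `ν`, and the exponential moment `∫ exp (a |f|)` is at most `B`. -/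
structure IsSubexp {E : Type*} [MeasurableSpace E] (ν : Measure E) (f : E → ℝ) (a B : ℝ) :
    Prop where
  measurable : Measurable f
  centered : ∫ x, f x ∂ν = 0
  integrable : Integrable (fun x => Real.exp (a * |f x|)) ν
  bound : ∫ x, Real.exp (a * |f x|) ∂ν ≤ B

section Tail

variable {E : Type*} [MeasurableSpace E] {ν : Measure E}
  {f : E → ℝ} {a B : ℝ}

lemma IsSubexp.integrable_exp_mul (h : IsSubexp ν f a B) (ha : 0 < a) {s : ℝ}
    (hs : |s| ≤ a / 2) : Integrable (fun x => Real.exp (s * f x)) ν := by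
  have hm := h.measurable
  refine h.integrable.mono' (by fun_prop) (ae_of_all _ fun x => ?_)
  rw [Real.norm_eq_abs, Real.abs_exp]
  refine Real.exp_le_exp.2 ((le_abs_self _).trans ?_)
  rw [abs_mul]
  exact mul_le_mul_of_nonneg_right (by linarith) (abs_nonneg _)

lemma IsSubexp.integral_exp_mul_le [IsProbabilityMeasure ν] (h : IsSubexp ν f a B) (ha : 0 < a)
    {s : ℝ} (hs : |s| ≤ a / 2) : ∫ x, Real.exp (s * f x) ∂ν ≤ Real.exp (8 * B * (s / a) ^ 2) := by
  have hm := h.measurable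
  have hf : Integrable f ν := by
    refine (h.integrable.const_mul a⁻¹).mono' (by fun_prop) (ae_of_all _ fun x => ?_)
    rw [Real.norm_eq_abs, inv_mul_eq_div, le_div_iff₀ ha, mul_comm]
    linarith [Real.add_one_le_exp (a * |f x|)]
  have hi' : Integrable (fun x => 1 + s * f x) ν := (integrable_const 1).add (hf.const_mul s)
  have hi : Integrable (fun x => 1 + s * f x + 8 * (s / a) ^ 2 * Real.exp (a * |f x|)) ν :=
    hi'.add (h.integrable.const_mul _)
  calc _ ≤ ∫ x, (1 + s * f x + 8 * (s / a) ^ 2 * Real.exp (a * |f x|)) ∂ν :=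
        integral_mono (h.integrable_exp_mul ha hs) hi fun x => exp_mul_le ha hs _
    _ = 1 + 8 * (s / a) ^ 2 * ∫ x, Real.exp (a * |f x|) ∂ν := by
        rw [integral_add hi' (h.integrable.const_mul _),
          integral_add (integrable_const 1) (hf.const_mul s), integral_const_mul,
          integral_const_mul, h.centered]
        simp
    _ ≤ 8 * (s / a) ^ 2 * B + 1 := by
        rw [add_comm]
        have := h.bound
        gcongr
    _ ≤ _ := by
        convert Real.add_one_le_exp (8 * B * (s / a) ^ 2) using 2
        ring

lemma IsSubexp.neg (h : IsSubexp ν f a B) : IsSubexp ν (fun x => -f x) a B :=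
  ⟨h.measurable.neg, by rw [integral_neg, h.centered, neg_zero], by simpa using h.integrable,
    by simpa using h.bound⟩

variable [IsProbabilityMeasure ν] {Ω : Type*} [MeasurableSpace Ω] {P : Measure Ω}
  [IsProbabilityMeasure P] {n : ℕ} {Z : Fin n → Ω → E}

/-- One-sided Bernstein-type bound, in the range where the optimal Chernoff exponent is
admissible. -/
lemma IsSubexp.measureReal_sum_ge_le (h : IsSubexp ν f a B) (ha : 0 < a) (hB : 0 < B)
    (hZ : ∀ i, Measurable (Z i)) (hmap : ∀ i, P.map (Z i) = ν) (hind : iIndepFun Z P)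
    {t : ℝ} (ht : 0 ≤ t) (ht' : t ≤ 8 * B / a) :
    P.real {ω | n * t ≤ ∑ i, f (Z i ω)} ≤ Real.exp (-(a ^ 2 / (32 * B) * n * t ^ 2)) := by
  have hm := h.measurable
  -- `s` minimizes `-s t + 8 B s² / a²`.
  set s := a ^ 2 * t / (16 * B) with hsdef
  have hs0 : 0 ≤ s := by positivity
  have hs : |s| ≤ a / 2 := by
    rw [abs_of_nonneg hs0, hsdef, div_le_iff₀ (by positivity)]
    rw [le_div_iff₀ ha] at ht'
    nlinarith
  set X : Fin n → Ω → ℝ := fun i ω => f (Z i ω)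
  have hX : ∀ i, Measurable (X i) := fun i => hm.comp (hZ i)
  have hXind : iIndepFun X P := hind.comp (fun _ => f) fun _ => hm
  have hXint : ∀ i, Integrable (fun ω => Real.exp (s * X i ω)) P := by
    intro i
    have h1 := h.integrable_exp_mul ha hs
    rw [← hmap i] at h1
    exact h1.comp_measurable (hZ i)
  have hXmgf : ∀ i, mgf (X i) P s ≤ Real.exp (8 * B * (s / a) ^ 2) := by
    intro i
    have h1 := h.integral_exp_mul_le ha hs
    rw [← hmap i, integral_map (hZ i).aemeasurable (by fun_prop)] at h1
    exact h1
  have h1 := measure_ge_le_exp_mul_mgf (μ := P) (X := ∑ i, X i) (n * t) hs0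
    (hXind.integrable_exp_mul_sum hX fun i _ => hXint i)
  rw [hXind.mgf_sum hX] at h1
  have h2 : ∏ i, mgf (X i) P s ≤ Real.exp (8 * B * (s / a) ^ 2) ^ n := by
    calc _ ≤ ∏ _i : Fin n, Real.exp (8 * B * (s / a) ^ 2) :=
          Finset.prod_le_prod (fun _ _ => mgf_nonneg) fun i _ => hXmgf i
      _ = _ := by simp
  have h3 : {ω | n * t ≤ ∑ i, f (Z i ω)} = {ω | n * t ≤ (∑ i, X i) ω} := by
    ext ω; simp [X]
  rw [h3]
  refine (h1.trans (mul_le_mul_of_nonneg_left h2 (Real.exp_pos _).le)).trans_eq ?_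
  rw [← Real.exp_nat_mul, ← Real.exp_add]
  congr 1
  rw [hsdef]
  field_simp
  ring

lemma IsSubexp.measureReal_abs_sum_ge_le (h : IsSubexp ν f a B) (ha : 0 < a) (hB : 0 < B)
    (hZ : ∀ i, Measurable (Z i)) (hmap : ∀ i, P.map (Z i) = ν) (hind : iIndepFun Z P)
    {t : ℝ} (ht : 0 ≤ t) (ht' : t ≤ 8 * B / a) :
    P.real {ω | n * t ≤ |∑ i, f (Z i ω)|} ≤ 2 * Real.exp (-(a ^ 2 / (32 * B) * n * t ^ 2)) := by
  have h1 := h.measureReal_sum_ge_le ha hB hZ hmap hind ht ht'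
  have h2 := h.neg.measureReal_sum_ge_le ha hB hZ hmap hind ht ht'
  have h3 : {ω | n * t ≤ |∑ i, f (Z i ω)|}
      = {ω | n * t ≤ ∑ i, f (Z i ω)} ∪ {ω | n * t ≤ ∑ i, -f (Z i ω)} := by
    ext ω
    simp [le_abs, Finset.sum_neg_distrib]
  rw [h3]
  linarith [measureReal_union_le (μ := P) {ω | n * t ≤ ∑ i, f (Z i ω)}
    {ω | n * t ≤ ∑ i, -f (Z i ω)}]

/-- Union bound over a finite family of sub-exponential functions of the observations. -/
lemma exists_event_abs_sum_lt {ι : Type*} [Fintype ι] {F : ι → E → ℝ}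
    (h : ∀ l, IsSubexp ν (F l) a B) (ha : 0 < a) (hB : 0 < B)
    (hZ : ∀ i, Measurable (Z i)) (hmap : ∀ i, P.map (Z i) = ν) (hind : iIndepFun Z P)
    {t : ℝ} (ht : 0 ≤ t) (ht' : t ≤ 8 * B / a) :
    ∃ A : Set Ω, MeasurableSet A ∧
      P.real Aᶜ ≤ Fintype.card ι * (2 * Real.exp (-(a ^ 2 / (32 * B) * n * t ^ 2))) ∧
      ∀ ω ∈ A, ∀ l, |∑ i, F l (Z i ω)| < n * t := by
  refine ⟨(⋃ l ∈ (Finset.univ : Finset ι), {ω | n * t ≤ |∑ i, F l (Z i ω)|})ᶜ, ?_, ?_, ?_⟩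
  · refine (Finset.measurableSet_biUnion _ fun l _ => measurableSet_le measurable_const ?_).compl
    have := (h l).measurable
    fun_prop
  · rw [compl_compl]
    refine (measureReal_biUnion_finset_le _ _).trans ?_
    refine (Finset.sum_le_sum fun l _ =>
      (h l).measureReal_abs_sum_ge_le ha hB hZ hmap hind ht ht').trans_eq ?_
    simp
  · intro ω hω l
    by_contra! hl
    exact hω (Set.mem_biUnion (Finset.mem_coe.2 (Finset.mem_univ l)) hl)

end Tail

/-! ### Exponential moments under the model -/

lemma integrable_exp_sq_gaussianReal (m : ℝ) {v : NNReal} (hv : v ≠ 0) {s : ℝ} (hs : v ≤ s) :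
    Integrable (fun x => Real.exp (1 / (4 * s) * (x - m) ^ 2)) (gaussianReal m v) ∧
      ∫ x, Real.exp (1 / (4 * s) * (x - m) ^ 2) ∂gaussianReal m v ≤ 2 := by
  have hv0 : (0 : ℝ) < v := by positivity
  have hs0 : 0 < s := hv0.trans_le hs
  set b : ℝ := 1 / (2 * v) - 1 / (4 * s) with hb
  have hb4 : 1 / (4 * v) ≤ b := by
    have h1 : 1 / (4 * s) ≤ 1 / (4 * (v : ℝ)) := by gcongr
    have h2 : 1 / (2 * (v : ℝ)) = 1 / (4 * v) + 1 / (4 * v) := by field_simp; norm_num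
    linarith
  have hb0 : 0 < b := lt_of_lt_of_le (by positivity) hb4
  have hprod : ∀ x, gaussianPDFReal m v x • Real.exp (1 / (4 * s) * (x - m) ^ 2)
      = (√(2 * Real.pi * v))⁻¹ * Real.exp (-b * (x - m) ^ 2) := by
    intro x
    rw [gaussianPDFReal, smul_eq_mul, mul_assoc, ← Real.exp_add]
    congr 2
    rw [hb]; ring
  have hint : Integrable (fun x => Real.exp (-b * (x - m) ^ 2)) :=
    (integrable_exp_neg_mul_sq hb0).comp_sub_right m
  constructor
  · rw [gaussianReal_of_var_ne_zero _ hv, integrable_withDensity_iff_integrable_smul'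
      (measurable_gaussianPDF _ _) (ae_of_all _ fun _ => gaussianPDF_lt_top)]
    simp only [toReal_gaussianPDF, hprod]
    exact hint.const_mul _
  · rw [integral_gaussianReal_eq_integral_smul hv]
    simp only [hprod]
    rw [integral_const_mul, integral_sub_right_eq_self (fun x => Real.exp (-b * x ^ 2)) m,
      integral_gaussian, ← Real.sqrt_inv, ← Real.sqrt_mul (by positivity)]
    refine Real.sqrt_le_iff.2 ⟨by norm_num, ?_⟩
    have h1 : Real.pi / b ≤ Real.pi * (4 * v) := by
      rw [div_le_iff₀ hb0]
      have h2 : 1 ≤ 4 * v * b := by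
        have := mul_le_mul_of_nonneg_left hb4 (by positivity : (0 : ℝ) ≤ 4 * v)
        rwa [mul_one_div_cancel (by positivity)] at this
      nlinarith [Real.pi_pos]
    calc (2 * Real.pi * v)⁻¹ * (Real.pi / b) ≤ (2 * Real.pi * v)⁻¹ * (Real.pi * (4 * v)) := by
          gcongr
      _ = 2 := by field_simp; norm_num
      _ ≤ 2 ^ 2 := by norm_num

namespace Model

variable {q p : ℕ} (L : Model q p)

/-- The law of the predictors in class `k`. -/
noncomputable abbrev classLaw (k : Fin (q + 1)) : Measure (EuclideanSpace ℝ (Fin p)) :=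
  multivariateGaussian (L.mean k) L.cov

instance isProbabilityMeasure_law : IsProbabilityMeasure L.law := by
  constructor
  simp only [law, Measure.coe_finsetSum, Finset.sum_apply, Measure.smul_apply, smul_eq_mul,
    measure_univ, mul_one]
  rw [← ENNReal.ofReal_sum_of_nonneg fun k _ => L.prior_nonneg k, L.prior_sum, ENNReal.ofReal_one]

lemma integrable_law {f : Fin (q + 1) × EuclideanSpace ℝ (Fin p) → ℝ} (hf : Measurable f)
    (hi : ∀ k, Integrable (fun x => f (k, x)) (L.classLaw k)) :
    Integrable f L.law ∧
      ∫ z, f z ∂L.law = ∑ k, L.prior k * ∫ x, f (k, x) ∂L.classLaw k := by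
  have h1 : ∀ k, Integrable f ((Measure.dirac k).prod (L.classLaw k)) := by
    intro k
    rw [Measure.dirac_prod, integrable_map_measure hf.aestronglyMeasurable (by fun_prop)]
    exact hi k
  have h2 : ∀ k ∈ (Finset.univ : Finset (Fin (q + 1))), Integrable f
      (ENNReal.ofReal (L.prior k) • (Measure.dirac k).prod (L.classLaw k)) :=
    fun k _ => (h1 k).smul_measure ENNReal.ofReal_ne_top
  refine ⟨integrable_finsetSum_measure.2 h2, ?_⟩
  rw [law, integral_finsetSum_measure h2]
  refine Finset.sum_congr rfl fun k _ => ?_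
  rw [integral_smul_measure, Measure.dirac_prod, integral_map (by fun_prop)
    hf.aestronglyMeasurable, ENNReal.toReal_ofReal (L.prior_nonneg k), smul_eq_mul]

/-- The `j`-th coordinate of the within-class deviation `X - μ_Y`. -/
noncomputable def dev (j : Fin p) (z : Fin (q + 1) × EuclideanSpace ℝ (Fin p)) : ℝ :=
  z.2 j - L.mean z.1 j

@[fun_prop]
lemma measurable_dev (j : Fin p) : Measurable (L.dev j) := by
  unfold dev
  have : Measurable fun k : Fin (q + 1) => L.mean k j := measurable_of_finite _
  fun_prop

lemma cov_diag_pos (j : Fin p) : 0 < L.cov j j := L.cov_posDef.diag_pos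

lemma abs_cov_le {s : ℝ} (hs : ∀ j, L.cov j j ≤ s) (i j : Fin p) : |L.cov i j| ≤ s := by
  have hS := L.cov_posDef.posSemidef
  have hsymm : L.cov j i = L.cov i j := by simpa using hS.isHermitian.apply i j
  have key : ∀ c : ℝ, 0 ≤ L.cov i i + 2 * c * L.cov i j + c ^ 2 * L.cov j j := by
    intro c
    have h := dotProduct_mulVec_nonneg_of_posSemidef hS (Pi.single i 1 + Pi.single j c)
    simp only [mulVec_add, dotProduct_add, add_dotProduct, mulVec_single, single_dotProduct] at h
    simp [hsymm] at h
    linarith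
  have h1 := key 1
  have h2 := key (-1)
  have h3 := hs i
  have h4 := hs j
  exact abs_le.2 ⟨by linarith, by linarith⟩

section Moments

variable {s : ℝ}

lemma exp_dev_sq (hs : ∀ j, L.cov j j ≤ s) (j : Fin p) (k : Fin (q + 1)) :
    Integrable (fun x => Real.exp (1 / (4 * s) * L.dev j (k, x) ^ 2)) (L.classLaw k) ∧
      ∫ x, Real.exp (1 / (4 * s) * L.dev j (k, x) ^ 2) ∂L.classLaw k ≤ 2 := by
  have hmp := measurePreserving_eval_multivariateGaussian (μ := L.mean k)
    L.cov_posDef.posSemidef (i := j)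
  have hv : (L.cov j j).toNNReal ≠ 0 := (Real.toNNReal_pos.2 (L.cov_diag_pos j)).ne'
  have h := integrable_exp_sq_gaussianReal (L.mean k j) hv (s := s)
    (by rw [Real.coe_toNNReal _ (L.cov_diag_pos j).le]; exact hs j)
  constructor
  · exact (hmp.integrable_comp (by fun_prop)).2 h.1
  · have h2 := h.2
    rw [← hmp.map_eq, integral_map hmp.measurable.aemeasurable (by fun_prop)] at h2
    exact h2

lemma exp_dev_sq_law (hs : ∀ j, L.cov j j ≤ s) (j : Fin p) :
    Integrable (fun z => Real.exp (1 / (4 * s) * L.dev j z ^ 2)) L.law ∧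
      ∫ z, Real.exp (1 / (4 * s) * L.dev j z ^ 2) ∂L.law ≤ 2 := by
  obtain ⟨h1, h2⟩ := L.integrable_law (f := fun z => Real.exp (1 / (4 * s) * L.dev j z ^ 2))
    (by fun_prop) fun k => (L.exp_dev_sq hs j k).1
  refine ⟨h1, h2.trans_le ?_⟩
  calc _ ≤ ∑ k, L.prior k * 2 := Finset.sum_le_sum fun k _ =>
        mul_le_mul_of_nonneg_left (L.exp_dev_sq hs j k).2 (L.prior_nonneg k)
    _ = 2 := by rw [← Finset.sum_mul, L.prior_sum, one_mul]

lemma memLp_eval (j : Fin p) (k : Fin (q + 1)) :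
    MemLp (fun x : EuclideanSpace ℝ (Fin p) => x j) 2 (L.classLaw k) := by
  have hmp := measurePreserving_eval_multivariateGaussian (μ := L.mean k)
    L.cov_posDef.posSemidef (i := j)
  exact (memLp_id_gaussianReal 2).comp_measurePreserving hmp

lemma integral_eval (j : Fin p) (k : Fin (q + 1)) :
    ∫ x, x j ∂L.classLaw k = L.mean k j := by
  have hmp := measurePreserving_eval_multivariateGaussian (μ := L.mean k)
    L.cov_posDef.posSemidef (i := j)
  have h := integral_id_gaussianReal (μ := L.mean k j) (v := (L.cov j j).toNNReal)
  rw [← hmp.map_eq, integral_map hmp.measurable.aemeasurable (by fun_prop)] at h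
  exact h

lemma integral_dev (j : Fin p) (k : Fin (q + 1)) :
    Integrable (fun x => L.dev j (k, x)) (L.classLaw k) ∧
      ∫ x, L.dev j (k, x) ∂L.classLaw k = 0 := by
  have h1 : Integrable (fun x : EuclideanSpace ℝ (Fin p) => x j) (L.classLaw k) :=
    (L.memLp_eval j k).integrable (by norm_num)
  refine ⟨h1.sub (integrable_const (L.mean k j)), ?_⟩
  change ∫ x : EuclideanSpace ℝ (Fin p), (x j - L.mean k j) ∂L.classLaw k = 0
  rw [integral_sub h1 (integrable_const _), L.integral_eval]
  simp

lemma integral_dev_mul_dev (i j : Fin p) (k : Fin (q + 1)) :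
    Integrable (fun x => L.dev i (k, x) * L.dev j (k, x)) (L.classLaw k) ∧
      ∫ x, L.dev i (k, x) * L.dev j (k, x) ∂L.classLaw k = L.cov i j := by
  have h : ∀ j, MemLp (fun x => L.dev j (k, x)) 2 (L.classLaw k) := fun j =>
    (L.memLp_eval j k).sub (memLp_const (L.mean k j))
  refine ⟨(h i).integrable_mul (h j), ?_⟩
  rw [← covariance_eval_multivariateGaussian (μ := L.mean k) L.cov_posDef.posSemidef i j,
    covariance]
  change _ = ∫ x, (x i - ∫ y, y i ∂L.classLaw k) * (x j - ∫ y, y j ∂L.classLaw k) ∂L.classLaw k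
  rw [L.integral_eval, L.integral_eval]
  rfl

lemma isSubexp_dev_mul_dev (hs1 : 1 ≤ s) (hs : ∀ j, L.cov j j ≤ s) (i j : Fin p) :
    IsSubexp L.law (fun z => L.dev i z * L.dev j z - L.cov i j) (1 / (4 * s)) 4 := by
  have hmeas : Measurable fun z => L.dev i z * L.dev j z - L.cov i j := by fun_prop
  obtain ⟨hi1, hi2⟩ := L.exp_dev_sq_law hs i
  obtain ⟨hj1, hj2⟩ := L.exp_dev_sq_law hs j
  have hdom : ∀ z, Real.exp (1 / (4 * s) * |L.dev i z * L.dev j z - L.cov i j|)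
      ≤ Real.exp (1 / (4 * s) * L.dev i z ^ 2) + Real.exp (1 / (4 * s) * L.dev j z ^ 2) := by
    intro z
    set u := L.dev i z
    set v := L.dev j z
    have h1 : |u * v - L.cov i j| ≤ (u ^ 2 + v ^ 2) / 2 + s := by
      refine (abs_sub _ _).trans (add_le_add ?_ (L.abs_cov_le hs i j))
      rw [abs_le]; constructor <;> nlinarith [sq_nonneg (u + v), sq_nonneg (u - v)]
    set a := 1 / (4 * s) with ha
    have ha0 : 0 ≤ a := by positivity
    have has : a * s = 1 / 4 := by rw [ha]; field_simp
    have h2 : a * |u * v - L.cov i j| ≤ 1 / 4 + (a * u ^ 2 / 2 + a * v ^ 2 / 2) := by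
      have := mul_le_mul_of_nonneg_left h1 ha0
      linarith
    have h3 : Real.exp (1 / 4) ≤ 2 := by
      have : Real.exp (1 / 4) ≤ Real.exp (Real.log 2) :=
        Real.exp_le_exp.2 (by linarith [Real.log_two_gt_d9])
      rwa [Real.exp_log (by norm_num)] at this
    have h4 : ∀ x : ℝ, Real.exp x = Real.exp (x / 2) ^ 2 := fun x => by
      rw [← Real.exp_nat_mul]; push_cast; ring_nf
    calc _ ≤ Real.exp (1 / 4 + (a * u ^ 2 / 2 + a * v ^ 2 / 2)) := Real.exp_le_exp.2 h2
      _ = Real.exp (1 / 4) * (Real.exp (a * u ^ 2 / 2) * Real.exp (a * v ^ 2 / 2)) := by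
          rw [Real.exp_add, Real.exp_add]
      _ ≤ 2 * (Real.exp (a * u ^ 2 / 2) * Real.exp (a * v ^ 2 / 2)) := by gcongr
      _ ≤ _ := by
          rw [h4 (a * u ^ 2), h4 (a * v ^ 2)]
          nlinarith [sq_nonneg (Real.exp (a * u ^ 2 / 2) - Real.exp (a * v ^ 2 / 2))]
  have hint := (hi1.add hj1).mono' (f := fun z => Real.exp (1 / (4 * s) *
      |L.dev i z * L.dev j z - L.cov i j|)) (by fun_prop) (ae_of_all _ fun z => by
    rw [Real.norm_eq_abs, Real.abs_exp]; exact hdom z)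
  refine ⟨hmeas, ?_, hint, ?_⟩
  · rw [(L.integrable_law hmeas fun k =>
      (L.integral_dev_mul_dev i j k).1.sub (integrable_const _)).2]
    refine Finset.sum_eq_zero fun k _ => ?_
    rw [integral_sub (L.integral_dev_mul_dev i j k).1 (integrable_const _),
      (L.integral_dev_mul_dev i j k).2]
    simp
  · refine (integral_mono hint (hi1.add hj1) hdom).trans ?_
    have := integral_add hi1 hj1
    refine this.trans_le ?_
    linarith

lemma isSubexp_class_dev (hs1 : 1 ≤ s) (hs : ∀ j, L.cov j j ≤ s) (k : Fin (q + 1)) (j : Fin p) :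
    IsSubexp L.law (fun z => if z.1 = k then L.dev j z else 0) (1 / (4 * s)) 4 := by
  have hset : MeasurableSet {z : Fin (q + 1) × EuclideanSpace ℝ (Fin p) | z.1 = k} :=
    measurable_fst (measurableSet_singleton k)
  have hmeas : Measurable fun z => if z.1 = k then L.dev j z else 0 :=
    Measurable.ite hset (by fun_prop) measurable_const
  obtain ⟨hj1, hj2⟩ := L.exp_dev_sq_law hs j
  have hdom : ∀ z, Real.exp (1 / (4 * s) * |if z.1 = k then L.dev j z else 0|)
      ≤ 2 * Real.exp (1 / (4 * s) * L.dev j z ^ 2) := by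
    intro z
    set u := L.dev j z
    have h1 : |if z.1 = k then u else 0| ≤ s + u ^ 2 := by
      split_ifs
      · rw [abs_le]; constructor <;> nlinarith [sq_nonneg (u + 1), sq_nonneg (u - 1)]
      · rw [abs_zero]; positivity
    set a := 1 / (4 * s) with ha
    have ha0 : 0 ≤ a := by positivity
    have has : a * s = 1 / 4 := by rw [ha]; field_simp
    have h3 : Real.exp (1 / 4) ≤ 2 := by
      have : Real.exp (1 / 4) ≤ Real.exp (Real.log 2) :=
        Real.exp_le_exp.2 (by linarith [Real.log_two_gt_d9])
      rwa [Real.exp_log (by norm_num)] at this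
    calc _ ≤ Real.exp (1 / 4 + a * u ^ 2) := Real.exp_le_exp.2 (by
          have := mul_le_mul_of_nonneg_left h1 ha0
          linarith)
      _ ≤ _ := by rw [Real.exp_add]; gcongr
  have hint := (hj1.const_mul 2).mono' (f := fun z => Real.exp (1 / (4 * s) *
      |if z.1 = k then L.dev j z else 0|)) (by fun_prop) (ae_of_all _ fun z => by
    rw [Real.norm_eq_abs, Real.abs_exp]; exact hdom z)
  refine ⟨hmeas, ?_, hint, ?_⟩
  · have h0 : ∀ l, Integrable (fun x => if (l, x).1 = k then L.dev j (l, x) else 0)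
          (L.classLaw l) ∧
        ∫ x, (if (l, x).1 = k then L.dev j (l, x) else 0) ∂L.classLaw l = 0 := by
      intro l
      by_cases hl : l = k
      · simpa only [hl, if_true] using L.integral_dev j k
      · simp [hl]
    rw [(L.integrable_law hmeas fun l => (h0 l).1).2]
    exact Finset.sum_eq_zero fun l _ => by rw [(h0 l).2, mul_zero]
  · refine (integral_mono hint (hj1.const_mul 2) hdom).trans ?_
    rw [integral_const_mul]
    linarith

lemma isSubexp_class (hs1 : 1 ≤ s) (k : Fin (q + 1)) :
    IsSubexp L.law (fun z => (if z.1 = k then 1 else 0) - L.prior k) (1 / (4 * s)) 4 := by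
  have hset : MeasurableSet {z : Fin (q + 1) × EuclideanSpace ℝ (Fin p) | z.1 = k} :=
    measurable_fst (measurableSet_singleton k)
  have hmeas : Measurable fun z : Fin (q + 1) × EuclideanSpace ℝ (Fin p) =>
      (if z.1 = k then (1 : ℝ) else 0) - L.prior k :=
    (Measurable.ite hset measurable_const measurable_const).sub measurable_const
  have hle : L.prior k ≤ 1 := by
    rw [← L.prior_sum]
    exact Finset.single_le_sum (fun l _ => L.prior_nonneg l) (Finset.mem_univ k)
  have hdom : ∀ z : Fin (q + 1) × EuclideanSpace ℝ (Fin p),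
      Real.exp (1 / (4 * s) * |(if z.1 = k then (1 : ℝ) else 0) - L.prior k|) ≤ 4 := by
    intro z
    have h0 := L.prior_nonneg k
    have h1 : |(if z.1 = k then (1 : ℝ) else 0) - L.prior k| ≤ 1 := by
      split_ifs <;> rw [abs_le] <;> constructor <;> linarith
    have h2 : 1 / (4 * s) ≤ 1 := by rw [div_le_one (by linarith)]; linarith
    have h3 : 1 / (4 * s) * |(if z.1 = k then (1 : ℝ) else 0) - L.prior k| ≤ 1 :=
      mul_le_one₀ h2 (abs_nonneg _) h1
    linarith [Real.exp_le_exp.2 h3, Real.exp_one_lt_d9]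
  have hint : Integrable (fun z : Fin (q + 1) × EuclideanSpace ℝ (Fin p) =>
      Real.exp (1 / (4 * s) * |(if z.1 = k then (1 : ℝ) else 0) - L.prior k|)) L.law :=
    (integrable_const (4 : ℝ)).mono' (by
      exact (measurable_const.mul hmeas.abs).exp.aestronglyMeasurable) (ae_of_all _ fun z => by
      rw [Real.norm_eq_abs, Real.abs_exp]; exact hdom z)
  refine ⟨hmeas, ?_, hint, ?_⟩
  · rw [(L.integrable_law hmeas fun l =>
      integrable_const ((if l = k then (1 : ℝ) else 0) - L.prior k)).2]
    have h0 : ∀ l, ∫ x, ((if (l, x).1 = k then (1 : ℝ) else 0) - L.prior k) ∂L.classLaw l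
        = (if l = k then (1 : ℝ) else 0) - L.prior k := fun l =>
      (integral_const ((if l = k then (1 : ℝ) else 0) - L.prior k)).trans (by simp)
    simp only [h0, mul_sub, Finset.sum_sub_distrib, ← Finset.sum_mul, L.prior_sum]
    simp
  · refine (integral_mono hint (integrable_const 4) hdom).trans ?_
    simp

end Moments

end Model

end MSDA

namespace MSDA

/-! ### Sample moments -/

section Sample

variable {q p n : ℕ} (z : Fin n → Fin (q + 1) × EuclideanSpace ℝ (Fin p))

lemma sum_classIdx (f : Fin n → ℝ) : ∑ k, ∑ i ∈ classIdx z k, f i = ∑ i, f i :=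
  Finset.sum_fiberwise Finset.univ (fun i => (z i).1) f

lemma sum_classIdx_eq_sum_ite (k : Fin (q + 1)) (f : Fin n → ℝ) :
    ∑ i ∈ classIdx z k, f i = ∑ i, if (z i).1 = k then f i else 0 :=
  Finset.sum_filter _ _

lemma posSemidef_sampleCov (hn : q + 1 ≤ n) : (sampleCov z).PosSemidef := by
  refine PosSemidef.smul (posSemidef_sum _ fun k _ => posSemidef_sum _ fun i _ => ?_) ?_
  · simpa using posSemidef_vecMulVec_self_star ((z i).2.ofLp - sampleMean z k)
  · exact inv_nonneg.2 (sub_nonneg.2 (by exact_mod_cast hn))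

variable (L : Model q p)

lemma card_mul_sampleMean_sub (k : Fin (q + 1)) (j : Fin p) (hk : 0 < (classIdx z k).card) :
    ((classIdx z k).card : ℝ) * (sampleMean z k j - L.mean k j)
      = ∑ i ∈ classIdx z k, L.dev j (z i) := by
  have h1 : ∑ i ∈ classIdx z k, L.dev j (z i)
      = ∑ i ∈ classIdx z k, ((z i).2.ofLp j - L.mean k j) := by
    refine Finset.sum_congr rfl fun i hi => ?_
    have : (z i).1 = k := (Finset.mem_filter.1 hi).2
    rw [Model.dev, this]
  have h2 : (0 : ℝ) < (classIdx z k).card := by exact_mod_cast hk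
  rw [h1, Finset.sum_sub_distrib, Finset.sum_const, nsmul_eq_mul, sampleMean, Pi.smul_apply,
    Finset.sum_apply, smul_eq_mul]
  field_simp

/-- Centering at the class means instead of the sample means changes the pooled scatter by a
rank-one term for each class. -/
lemma sampleCov_apply (hn : ∀ k, 0 < (classIdx z k).card) (a b : Fin p) :
    sampleCov z a b = ((n : ℝ) - ((q + 1 : ℕ) : ℝ))⁻¹ *
      (∑ i, L.dev a (z i) * L.dev b (z i)
        - ∑ k, (sampleMean z k a - L.mean k a) * ∑ i ∈ classIdx z k, L.dev b (z i)) := by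
  have h1 : ∀ k, ∑ i ∈ classIdx z k,
      ((z i).2.ofLp a - sampleMean z k a) * ((z i).2.ofLp b - sampleMean z k b)
      = ∑ i ∈ classIdx z k, L.dev a (z i) * L.dev b (z i)
        - (sampleMean z k a - L.mean k a) * ∑ i ∈ classIdx z k, L.dev b (z i) := by
    intro k
    have ha := card_mul_sampleMean_sub z L k a (hn k)
    have hb := card_mul_sampleMean_sub z L k b (hn k)
    set x := sampleMean z k a - L.mean k a
    set y := sampleMean z k b - L.mean k b
    have h2 : ∀ i ∈ classIdx z k,
        ((z i).2.ofLp a - sampleMean z k a) * ((z i).2.ofLp b - sampleMean z k b)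
        = L.dev a (z i) * L.dev b (z i) - y * L.dev a (z i) - x * L.dev b (z i) + x * y := by
      intro i hi
      have h3 : (z i).1 = k := (Finset.mem_filter.1 hi).2
      simp only [Model.dev, h3, x, y]
      ring
    rw [Finset.sum_congr rfl h2, Finset.sum_add_distrib, Finset.sum_sub_distrib,
      Finset.sum_sub_distrib, ← Finset.mul_sum, ← Finset.mul_sum, Finset.sum_const, nsmul_eq_mul,
      ← ha, ← hb]
    ring
  have h2 : sampleCov z a b = ((n : ℝ) - ((q + 1 : ℕ) : ℝ))⁻¹ * ∑ k, ∑ i ∈ classIdx z k,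
      ((z i).2.ofLp a - sampleMean z k a) * ((z i).2.ofLp b - sampleMean z k b) := by
    simp only [sampleCov, Matrix.smul_apply, Matrix.sum_apply, smul_eq_mul, vecMulVec_apply,
      Pi.sub_apply]
  rw [h2, Finset.sum_congr rfl fun k _ => h1 k, Finset.sum_sub_distrib, sum_classIdx]

/-- If the empirical sums that define the sample moments deviate from their expectations by at
most `n t`, then the sample moments are accurate up to a multiple of `t`. Here `g` is half of a
lower bound on the class probabilities. -/
lemma sample_moments_close {s g t : ℝ} (hg : 0 < g) (hprior : ∀ k, 2 * g ≤ L.prior k)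
    (ht : 0 < t) (htg : t ≤ g) (ht2 : t ≤ 1 / 2) (hs1 : 1 ≤ s) (hs : ∀ j, L.cov j j ≤ s)
    (hn : ((q + 1 : ℕ) : ℝ) * s ≤ n * t) (T : Finset (Fin p))
    (h1 : ∀ a, ∀ b ∈ T, |∑ i, (L.dev a (z i) * L.dev b (z i) - L.cov a b)| ≤ n * t)
    (h2 : ∀ k j, |∑ i, if (z i).1 = k then L.dev j (z i) else 0| ≤ n * t)
    (h3 : ∀ k, |∑ i, ((if (z i).1 = k then (1 : ℝ) else 0) - L.prior k)| ≤ n * t) :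
    (∀ a, ∀ b ∈ T, |sampleCov z a b - L.cov a b| ≤ (4 * (q + 1) + 2) * t) ∧
      ∀ k j, |sampleMean z k j - L.mean k j| ≤ t / g := by
  have hK : (0 : ℝ) < ((q + 1 : ℕ) : ℝ) := by positivity
  have hn0 : (0 : ℝ) < n := by
    have : 0 < (n : ℝ) * t := lt_of_lt_of_le (by positivity) hn
    exact pos_of_mul_pos_left this ht.le
  have hn2 : (n : ℝ) / 2 ≤ n - ((q + 1 : ℕ) : ℝ) := by
    have ha : (n : ℝ) * t ≤ n * (1 / 2) := by gcongr
    have hb : ((q + 1 : ℕ) : ℝ) * 1 ≤ ((q + 1 : ℕ) : ℝ) * s := by gcongr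
    linarith
  have hcard : ∀ k, n * g ≤ ((classIdx z k).card : ℝ) := by
    intro k
    have ha : ∑ i, ((if (z i).1 = k then (1 : ℝ) else 0) - L.prior k)
        = (classIdx z k).card - n * L.prior k := by
      rw [Finset.sum_sub_distrib, ← sum_classIdx_eq_sum_ite z k fun _ => (1 : ℝ)]
      simp
    have hb := h3 k
    rw [ha] at hb
    have hc := (abs_le.1 hb).1
    nlinarith [hprior k]
  have hcard0 : ∀ k, 0 < (classIdx z k).card := fun k => by
    have : (0 : ℝ) < (classIdx z k).card := (mul_pos hn0 hg).trans_le (hcard k)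
    exact_mod_cast this
  have h2' : ∀ k j, |∑ i ∈ classIdx z k, L.dev j (z i)| ≤ n * t := fun k j => by
    rw [sum_classIdx_eq_sum_ite]; exact h2 k j
  have hmean : ∀ k j, |sampleMean z k j - L.mean k j| ≤ t / g := by
    intro k j
    have ha := h2' k j
    rw [← card_mul_sampleMean_sub z L k j (hcard0 k), abs_mul, Nat.abs_cast] at ha
    have hb : n * g * |sampleMean z k j - L.mean k j| ≤ n * t :=
      (mul_le_mul_of_nonneg_right (hcard k) (abs_nonneg _)).trans ha
    rw [le_div_iff₀ hg]
    rw [mul_assoc] at hb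
    have := le_of_mul_le_mul_left hb hn0
    linarith
  refine ⟨fun a b hb => ?_, hmean⟩
  rw [sampleCov_apply z L hcard0]
  set N : ℝ := (n : ℝ) - ((q + 1 : ℕ) : ℝ)
  have hN : 0 < N := by linarith
  set R := ∑ k, (sampleMean z k a - L.mean k a) * ∑ i ∈ classIdx z k, L.dev b (z i)
  have hR : |R| ≤ (q + 1) * (n * t) := by
    calc |R| ≤ ∑ k, |(sampleMean z k a - L.mean k a) * ∑ i ∈ classIdx z k, L.dev b (z i)| :=
          Finset.abs_sum_le_sum_abs _ _
      _ ≤ ∑ _k : Fin (q + 1), 1 * (n * t) := by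
          refine Finset.sum_le_sum fun k _ => ?_
          rw [abs_mul]
          exact mul_le_mul ((hmean k a).trans ((div_le_one hg).2 htg)) (h2' k b) (abs_nonneg _)
            zero_le_one
      _ = _ := by simp
  have hG := h1 a b hb
  have e1 : ∑ i, (L.dev a (z i) * L.dev b (z i) - L.cov a b)
      = ∑ i, L.dev a (z i) * L.dev b (z i) - n * L.cov a b := by
    rw [Finset.sum_sub_distrib]; simp
  rw [e1] at hG
  set W := ∑ i, L.dev a (z i) * L.dev b (z i)
  have e2 : N⁻¹ * (W - R) - L.cov a b
      = N⁻¹ * ((W - n * L.cov a b) - R + ((q + 1 : ℕ) : ℝ) * L.cov a b) := by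
    field_simp
    simp only [N]
    ring
  have h4 : |((q + 1 : ℕ) : ℝ) * L.cov a b| ≤ n * t := by
    rw [abs_mul, Nat.abs_cast]
    exact (mul_le_mul_of_nonneg_left (L.abs_cov_le hs a b) hK.le).trans hn
  have h5 : |(W - n * L.cov a b) - R + ((q + 1 : ℕ) : ℝ) * L.cov a b|
      ≤ n * t + (q + 1) * (n * t) + n * t :=
    (abs_add_le _ _).trans (add_le_add ((abs_sub _ _).trans (add_le_add hG hR)) h4)
  rw [e2, abs_mul, abs_of_pos (inv_pos.2 hN), inv_mul_le_iff₀ hN]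
  have h6 : n * t + (q + 1) * (n * t) + n * t ≤ n / 2 * ((4 * (q + 1) + 2) * t) := by
    have : 0 ≤ n * t * q := by positivity
    nlinarith
  have h7 : n / 2 * ((4 * (q + 1) + 2) * t) ≤ N * ((4 * (q + 1) + 2) * t) := by gcongr
  linarith

end Sample

namespace Model

/-- The sample moments are accurate to order `e / d` up to an event of probability
`C p d exp(-c n e² / d²)`, with constants that depend on the model only through the number of
classes and the bounds on the variances and on the class probabilities. -/
theorem exists_event_moments_close (q : ℕ) {s g T : ℝ} (hs1 : 1 ≤ s) (hg : 0 < g) (hT : 0 < T) :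
    ∃ C c : ℝ, 0 < C ∧ 0 < c ∧ ∀ (n p : ℕ) (L : Model q p) (e : ℝ)
      (Ω : Type*) (_ : MeasurableSpace Ω) (P : Measure Ω) (_ : IsProbabilityMeasure P)
      (Z : Fin n → Ω → Fin (q + 1) × EuclideanSpace ℝ (Fin p)),
      L.IsSample P Z → L.D.Nonempty → (∀ j, L.cov j j ≤ s) → (∀ k, 2 * g ≤ L.prior k) →
      0 < e → e ≤ T →
      ∃ A : Set Ω, MeasurableSet A ∧
        P.real Aᶜ ≤ C * p * L.d * Real.exp (-(c * n * (e ^ 2 / L.d ^ 2))) ∧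
        ∀ ω ∈ A, (sampleCov fun i => Z i ω).PosSemidef ∧
          (∀ a, ∀ b ∈ L.D, |sampleCov (fun i => Z i ω) a b - L.cov a b| ≤ e / L.d) ∧
          ∀ (k : Fin q) (j : Fin p),
            |(sampleMean (fun i => Z i ω) k.succ - sampleMean (fun i => Z i ω) 0) j
              - ((L.mean k.succ).ofLp j - (L.mean 0).ofLp j)| ≤ e := by
  -- The empirical sums are controlled at level `t = r e / d`.
  set r : ℝ := (4 * (q + 1) + 2 + 2 / g + T / g + 2 * T)⁻¹ with hr
  have hr0 : 0 < r := by positivity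
  have hr1 : r * (4 * (q + 1) + 2) + r * (2 / g) + r * (T / g) + r * (2 * T) = 1 := by
    rw [← mul_add, ← mul_add, ← mul_add]
    exact inv_mul_cancel₀ (by positivity)
  have p1 : 0 < r * (4 * ((q : ℝ) + 1) + 2) := by positivity
  have p2 : 0 < r * (2 / g) := by positivity
  have p3 : 0 < r * (T / g) := by positivity
  have p4 : 0 < r * (2 * T) := by positivity
  set c₀ : ℝ := (1 / (4 * s)) ^ 2 / (32 * 4) with hc₀
  have hc₀0 : 0 < c₀ := by positivity
  set C₀ : ℝ := Real.exp (c₀ * ((q + 1) * s)) with hC₀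
  refine ⟨2 * (2 * q + 3) + C₀, c₀ * r ^ 2, by positivity, by positivity, ?_⟩
  intro n p L e Ω _ P _ Z hZ hD hs hprior he heT
  have hd : 1 ≤ L.d := hD.card_pos
  have hdp : L.d ≤ p := (Finset.card_le_univ _).trans_eq (Fintype.card_fin p)
  have hd' : (1 : ℝ) ≤ L.d := by exact_mod_cast hd
  have hp' : (1 : ℝ) ≤ p := by exact_mod_cast hd.trans hdp
  have hpd : (1 : ℝ) ≤ p * L.d := one_le_mul_of_one_le_of_one_le hp' hd'
  set t : ℝ := r * (e / L.d) with ht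
  have hed : e / L.d ≤ e := div_le_self he.le hd'
  have ht0 : 0 < t := by positivity
  have htT : t ≤ r * T := mul_le_mul_of_nonneg_left (hed.trans heT) hr0.le
  have htg : t ≤ g := by
    have h1 : r * (T / g) * g ≤ 1 * g := by gcongr; linarith
    have h2 : r * (T / g) * g = r * T := by field_simp
    linarith
  have ht2 : t ≤ 1 / 2 := by linarith
  have hexp : c₀ * r ^ 2 * n * (e ^ 2 / L.d ^ 2) = c₀ * n * t ^ 2 := by
    rw [ht]; field_simp
  rw [hexp]
  by_cases hsmall : (n : ℝ) * t < ((q + 1 : ℕ) : ℝ) * s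
  · -- The sample is so small that the bound is trivial.
    refine ⟨∅, MeasurableSet.empty, ?_, fun ω hω => hω.elim⟩
    rw [Set.compl_empty, probReal_univ]
    have h1 : c₀ * n * t ^ 2 ≤ c₀ * ((q + 1) * s) := by
      push_cast at hsmall
      have h2 : n * t ^ 2 ≤ (q + 1) * s := by
        have : (n : ℝ) * t ^ 2 = n * t * t := by ring
        rw [this]
        have h3 : (n : ℝ) * t * t ≤ n * t * 1 := by gcongr; linarith
        linarith
      rw [mul_assoc]
      gcongr
    have h2 : 1 ≤ C₀ * Real.exp (-(c₀ * n * t ^ 2)) := by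
      rw [hC₀, ← Real.exp_add]; exact Real.one_le_exp (by linarith)
    have h3 : 0 ≤ 2 * (2 * (q : ℝ) + 3) * Real.exp (-(c₀ * n * t ^ 2)) := by positivity
    calc 1 ≤ (2 * (2 * q + 3) + C₀) * Real.exp (-(c₀ * n * t ^ 2)) := by linarith
      _ ≤ (p * L.d) * ((2 * (2 * q + 3) + C₀) * Real.exp (-(c₀ * n * t ^ 2))) :=
          le_mul_of_one_le_left (by positivity) hpd
      _ = _ := by ring
  · push Not at hsmall
    set F : (Fin p × {j // j ∈ L.D}) ⊕ (Fin (q + 1) × Fin p) ⊕ Fin (q + 1) →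
        Fin (q + 1) × EuclideanSpace ℝ (Fin p) → ℝ :=
      Sum.elim (fun l z => L.dev l.1 z * L.dev l.2 z - L.cov l.1 l.2)
        (Sum.elim (fun l z => if z.1 = l.1 then L.dev l.2 z else 0)
          (fun k z => (if z.1 = k then 1 else 0) - L.prior k)) with hF
    have hsub : ∀ l, IsSubexp L.law (F l) (1 / (4 * s)) 4 := by
      rintro (l | l | k)
      · exact L.isSubexp_dev_mul_dev hs1 hs _ _
      · exact L.isSubexp_class_dev hs1 hs _ _
      · exact L.isSubexp_class hs1 k
    obtain ⟨A, hA, hPA, hAbound⟩ := exists_event_abs_sum_lt (n := n) hsub (by positivity)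
      (by norm_num) hZ.measurable hZ.map_eq hZ.indep ht0.le (by
        have : 8 * 4 / (1 / (4 * s)) = 128 * s := by field_simp; norm_num
        rw [this]; linarith)
    refine ⟨A, hA, hPA.trans ?_, fun ω hω => ?_⟩
    · have hcard : (Fintype.card ((Fin p × {j // j ∈ L.D}) ⊕ (Fin (q + 1) × Fin p) ⊕ Fin (q + 1))
          : ℝ) = p * L.d + ((q + 1) * p + (q + 1)) := by
        simp [d]
      rw [hcard]
      have h1 : (p : ℝ) * L.d + ((q + 1) * p + (q + 1)) ≤ (2 * q + 3) * (p * L.d) := by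
        have h2 : (p : ℝ) ≤ p * L.d := le_mul_of_one_le_right (by positivity) hd'
        have h3 : ((q : ℝ) + 1) * p ≤ (q + 1) * (p * L.d) := by gcongr
        have h4 : ((q : ℝ) + 1) * 1 ≤ (q + 1) * (p * L.d) := by gcongr
        linarith
      have hE := (Real.exp_pos (-(c₀ * n * t ^ 2))).le
      calc _ ≤ (2 * q + 3) * (p * L.d) * (2 * Real.exp (-(c₀ * n * t ^ 2))) := by gcongr
        _ = 2 * (2 * q + 3) * (p * L.d * Real.exp (-(c₀ * n * t ^ 2))) := by ring
        _ ≤ (2 * (2 * q + 3) + C₀) * (p * L.d * Real.exp (-(c₀ * n * t ^ 2))) := by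
            have : 0 ≤ C₀ := (Real.exp_pos _).le
            gcongr
            linarith
        _ = _ := by ring
    · have hb := hAbound ω hω
      obtain ⟨h1, h2⟩ := sample_moments_close (fun i => Z i ω) L hg hprior ht0 htg ht2 hs1 hs
        hsmall L.D (fun a b hb' => (hb (Sum.inl (a, ⟨b, hb'⟩))).le)
        (fun k j => (hb (Sum.inr (Sum.inl (k, j)))).le) (fun k => (hb (Sum.inr (Sum.inr k))).le)
      have hn : q + 1 ≤ n := by
        have h3 : (n : ℝ) * t ≤ n * 1 := by gcongr; linarith
        have h4 : ((q + 1 : ℕ) : ℝ) * 1 ≤ ((q + 1 : ℕ) : ℝ) * s := by gcongr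
        have : ((q + 1 : ℕ) : ℝ) ≤ n := by linarith
        exact_mod_cast this
      refine ⟨posSemidef_sampleCov _ hn, fun a b hb' => (h1 a b hb').trans ?_, fun k j => ?_⟩
      · have h3 : (4 * ((q : ℝ) + 1) + 2) * t = r * (4 * (q + 1) + 2) * (e / L.d) := by
          rw [ht]; ring
        rw [h3]
        refine mul_le_of_le_one_left (by positivity) ?_
        linarith
      · have h3 := h2 k.succ j
        have h4 := h2 0 j
        have h5 : t / g + t / g ≤ e := by
          have : t / g + t / g = r * (2 / g) * (e / L.d) := by rw [ht]; ring
          rw [this]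
          refine (mul_le_of_le_one_left (by positivity) ?_).trans hed
          linarith
        have h6 : (sampleMean (fun i => Z i ω) k.succ - sampleMean (fun i => Z i ω) 0) j
            - ((L.mean k.succ).ofLp j - (L.mean 0).ofLp j)
            = (sampleMean (fun i => Z i ω) k.succ j - L.mean k.succ j)
              - (sampleMean (fun i => Z i ω) 0 j - L.mean 0 j) := by
          rw [Pi.sub_apply]; ring
        rw [h6]
        exact (abs_sub _ _).trans ((add_le_add h3 h4).trans h5)

end Model

end MSDA

namespace MSDA

/-! ### Support recovery with high probability -/

universe u

namespace Model

/-- If the moments are estimated with an accuracy `e` that is at most a small multiple of `λ`,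
the penalized problem recovers the support up to an event of probability
`C p d exp(-c n e² / d²)`. -/
theorem exists_event_success (q : ℕ) {s g T η Δ κ₀ : ℝ} (hs1 : 1 ≤ s) (hg : 0 < g) (hT : 0 < T)
    (hη : 0 ≤ η) (hΔ : 0 ≤ Δ) (hκ₀ : κ₀ < 1) :
    ∃ C c : ℝ, 0 < C ∧ 0 < c ∧ ∀ (n p : ℕ) (L : Model q p) (e lam : ℝ)
      (Ω : Type u) (_ : MeasurableSpace Ω) (P : Measure Ω) (_ : IsProbabilityMeasure P)
      (Z : Fin n → Ω → Fin (q + 1) × EuclideanSpace ℝ (Fin p)),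
      L.IsSample P Z → L.D.Nonempty → (∀ j, L.cov j j ≤ s) → (∀ k, 2 * g ≤ L.prior k) →
      L.Delta ≤ Δ → L.etaStar ≤ η → L.kappa ≤ κ₀ →
      0 < e → e ≤ T → e * L.phi ≤ 1 / 2 → 0 < lam →
      e ≤ (1 - κ₀) / (3 * (q + 1) * (1 + η) * (1 + 2 * Δ)) * lam →
      4 * L.phi * lam < L.thetaMin →
      24 * q ^ 2 * L.etaStar * L.phi * lam ≤ (1 - L.kappa) * L.thetaMin →
      ∃ A : Set Ω, MeasurableSet A ∧
        P.real Aᶜ ≤ C * p * L.d * Real.exp (-(c * n * (e ^ 2 / L.d ^ 2))) ∧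
        ∀ ω ∈ A, Success (fun i => Z i ω) L lam := by
  obtain ⟨C, c, hC, hc, h⟩ := exists_event_moments_close.{u} q hs1 hg hT
  refine ⟨C, c, hC, hc, ?_⟩
  intro n p L e lam Ω mΩ P hP Z hZ hD hs hprior hLΔ hLη hLκ he heT heφ hlam hel hmin hdual
  obtain ⟨A, hA, hPA, hAS⟩ := h n p L e Ω mΩ P hP Z hZ hD hs hprior he heT
  refine ⟨A, hA, hPA, fun ω hω => ?_⟩
  obtain ⟨hS, hSe, hδ⟩ := hAS ω hω
  have hκ := L.kappa_nonneg
  have hD0 := L.Delta_nonneg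
  have hη0 := L.etaStar_nonneg
  have hel' : e * (3 * (q + 1) * (1 + η) * (1 + 2 * Δ)) ≤ (1 - κ₀) * lam := by
    rw [div_mul_eq_mul_div, le_div_iff₀ (by positivity)] at hel
    exact hel
  have h1 : (q + 1) * (e * ((1 + L.etaStar) * (1 + 2 * L.Delta))) ≤ lam * ((1 - κ₀) / 3) := by
    have : (q + 1) * (e * ((1 + L.etaStar) * (1 + 2 * L.Delta)))
        ≤ (q + 1) * (e * ((1 + η) * (1 + 2 * Δ))) := by gcongr
    linarith
  have h2 : lam * ((1 - κ₀) / 3) ≤ lam * ((1 - L.kappa) / 3) := by gcongr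
  have h3 : 0 ≤ e * ((1 + L.etaStar) * (1 + 2 * L.Delta)) := by positivity
  have h4 : e * (1 + L.Delta) ≤ lam := by
    have ha : e * (1 + L.Delta) ≤ e * ((1 + L.etaStar) * (1 + 2 * L.Delta)) := by
      gcongr
      nlinarith [mul_nonneg hη0 hD0]
    have hb : 0 ≤ (q : ℝ) * (e * ((1 + L.etaStar) * (1 + 2 * L.Delta))) := by positivity
    have hc' : lam * ((1 - κ₀) / 3) ≤ lam * 1 := by gcongr; linarith
    linarith
  obtain ⟨θ, ha, hb, hc, hd⟩ := groupLasso_support_recovery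
    (δ := fun k => sampleMean (fun i => Z i ω) k.succ - sampleMean (fun i => Z i ω) 0)
    hS he.le hD hSe hδ hlam heφ h4 hmin (hLκ.trans_lt hκ₀) (by linarith) hdual
  exact ⟨θ, ha, hb, hc, hd⟩

end Model

variable {q : ℕ} {c₁ C₁ φ₀ Δ₀ η₀ s₀ : ℝ}

/-- The non-asymptotic bound. -/
theorem nonasymptotic_recovery (hc₁ : 0 < c₁) (θ₀ : ℝ) (hθ₀ : 0 < θ₀) :
    ∃ M : ℝ, 0 < M ∧ ∀ κ₀ : ℝ, κ₀ < 1 → ∃ C c : ℝ, 0 < C ∧ 0 < c ∧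
      ∀ (n p : ℕ) (L : Model q p) (lam ε : ℝ)
        (Ω : Type u) (_ : MeasurableSpace Ω) (P : Measure Ω) (_ : IsProbabilityMeasure P)
        (Z : Fin n → Ω → Fin (q + 1) × EuclideanSpace ℝ (Fin p)),
        L.IsSample P Z → L.D.Nonempty →
        L.phi ≤ φ₀ → L.Delta ≤ Δ₀ → L.etaStar ≤ η₀ → (∀ j, L.cov j j ≤ s₀) →
        θ₀ ≤ L.thetaMin → L.kappa ≤ κ₀ → L.Balanced c₁ C₁ →
        lam < min (L.thetaMin / (8 * L.phi)) (M * (1 - L.kappa)) →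
        0 < ε → ε < min (1 / (2 * L.phi)) (lam / (1 + L.phi * L.Delta)) →
        ∃ A : Set Ω, MeasurableSet A ∧
          1 - C * p * L.d * Real.exp (-(c * n * (ε ^ 2 / (((q + 1 : ℕ) : ℝ) * L.d ^ 2))))
            - C * ((q + 1 : ℕ) : ℝ) * Real.exp (-(c * (n / ((q + 1 : ℕ) : ℝ) ^ 2)))
            - C * p * (((q + 1 : ℕ) : ℝ) - 1)
              * Real.exp (-(c * n * (ε ^ 2 / ((q + 1 : ℕ) : ℝ)))) < P.real A ∧
          ∀ ω ∈ A, Success (fun i => Z i ω) L lam := by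
  set φ := |φ₀|
  set η := |η₀|
  set Δ := |Δ₀|
  have hφ : 0 ≤ φ := abs_nonneg _
  have hη : 0 ≤ η := abs_nonneg _
  have hΔ : 0 ≤ Δ := abs_nonneg _
  -- `M` makes the change of the subgradient at the estimate small compared to `1 - κ`.
  set M : ℝ := θ₀ / (24 * q ^ 2 * η * φ + 1) with hM
  have hM0 : 0 < M := by positivity
  have hMle : 24 * q ^ 2 * η * φ * M ≤ θ₀ := by
    have h1 : (24 * q ^ 2 * η * φ + 1) * M = θ₀ := mul_div_cancel₀ _ (by positivity)
    linarith
  refine ⟨M, hM0, fun κ₀ hκ₀ => ?_⟩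
  have hκ₀' : 0 < 1 - κ₀ := by linarith
  obtain ⟨C, c, hC, hc, h⟩ := Model.exists_event_success.{u} q (s := max s₀ 1)
    (g := c₁ / (2 * ((q + 1 : ℕ) : ℝ))) (le_max_right _ _) (by positivity) hM0 hη hΔ hκ₀
  set a : ℝ := (1 - κ₀) / (3 * (q + 1) * (1 + η) * (1 + 2 * Δ)) with ha
  have ha0 : 0 < a := by positivity
  refine ⟨C, c * a ^ 2, hC, by positivity, ?_⟩
  intro n p L lam ε Ω mΩ P hP Z hZ hD hLφ hLΔ hLη hs hθ hκ hbal hlam hε hεlt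
  rw [lt_min_iff] at hlam hεlt
  have hφ0 := L.phi_nonneg
  have hΔ0 := L.Delta_nonneg
  have hη0 := L.etaStar_nonneg
  have hκ0 := L.kappa_nonneg
  have hφpos : 0 < L.phi := by
    rcases hφ0.eq_or_lt with h0 | h0
    · rw [← h0, mul_zero, div_zero] at hεlt
      exact absurd hεlt.1 (not_lt.2 hε.le)
    · exact h0
  have hden : 1 ≤ 1 + L.phi * L.Delta := by nlinarith [mul_nonneg hφ0 hΔ0]
  have hεlam : ε * (1 + L.phi * L.Delta) < lam := (lt_div_iff₀ (by linarith)).1 hεlt.2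
  have hεlam' : ε < lam := by nlinarith
  have hlam0 : 0 < lam := hε.trans hεlam'
  have hlam8 : lam * (8 * L.phi) < L.thetaMin := (lt_div_iff₀ (by positivity)).1 hlam.1
  have hεφ : ε * (2 * L.phi) < 1 := (lt_div_iff₀ (by positivity)).1 hεlt.1
  have ha1 : a ≤ 1 := by
    rw [ha, div_le_one (by positivity)]
    have : (1 : ℝ) * 1 * 1 * 1 ≤ 3 * (q + 1) * (1 + η) * (1 + 2 * Δ) := by
      gcongr <;> linarith [(Nat.cast_nonneg q : (0 : ℝ) ≤ q)]
    linarith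
  have haε : a * ε ≤ ε := mul_le_of_le_one_left hε.le ha1
  obtain ⟨A, hA, hPA, hAS⟩ := h n p L (a * ε) lam Ω mΩ P hP Z hZ hD
    (fun j => (hs j).trans (le_max_left _ _))
    (fun k => le_of_eq_of_le (by field_simp) (hbal.1 k).1)
    (hLΔ.trans (le_abs_self _)) (hLη.trans (le_abs_self _)) hκ (by positivity)
    (by nlinarith [hlam.2])
    (by nlinarith) hlam0 (by gcongr) (by nlinarith)
    (by
      calc 24 * (q : ℝ) ^ 2 * L.etaStar * L.phi * lam
          ≤ 24 * q ^ 2 * η * φ * (M * (1 - L.kappa)) := by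
            have h1 := hLη.trans (le_abs_self _)
            have h2 := hLφ.trans (le_abs_self _)
            gcongr
            exact hlam.2.le
        _ = (1 - L.kappa) * (24 * q ^ 2 * η * φ * M) := by ring
        _ ≤ (1 - L.kappa) * L.thetaMin := by
            have : 0 ≤ 1 - L.kappa := by linarith
            exact mul_le_mul_of_nonneg_left (hMle.trans hθ) this)
  refine ⟨A, hA, ?_, hAS⟩
  rw [probReal_compl_eq_one_sub hA] at hPA
  have hd : (0 : ℝ) < L.d := by exact_mod_cast hD.card_pos
  have h1 : c * a ^ 2 * n * (ε ^ 2 / (((q + 1 : ℕ) : ℝ) * L.d ^ 2))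
      ≤ c * n * ((a * ε) ^ 2 / L.d ^ 2) := by
    have h2 : c * n * ((a * ε) ^ 2 / L.d ^ 2) = c * a ^ 2 * n * (ε ^ 2 / (1 * L.d ^ 2)) := by
      field_simp
    rw [h2]
    gcongr
    push_cast
    linarith [(Nat.cast_nonneg q : (0 : ℝ) ≤ q)]
  have h2 : C * p * L.d * Real.exp (-(c * n * ((a * ε) ^ 2 / L.d ^ 2)))
      ≤ C * p * L.d *
        Real.exp (-(c * a ^ 2 * n * (ε ^ 2 / (((q + 1 : ℕ) : ℝ) * L.d ^ 2)))) := by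
    gcongr
  have h3 : 0 < C * ((q + 1 : ℕ) : ℝ)
      * Real.exp (-(c * a ^ 2 * (n / ((q + 1 : ℕ) : ℝ) ^ 2))) := by positivity
  have h4 : 0 ≤ C * p * (((q + 1 : ℕ) : ℝ) - 1)
      * Real.exp (-(c * a ^ 2 * n * (ε ^ 2 / ((q + 1 : ℕ) : ℝ)))) := by
    have : (0 : ℝ) ≤ ((q + 1 : ℕ) : ℝ) - 1 := by
      push_cast
      linarith [(Nat.cast_nonneg q : (0 : ℝ) ≤ q)]
    positivity
  linarith

/-- The asymptotic version: the accuracy `e` is a fixed small multiple of `λ`. -/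
theorem asymptotic_recovery (hc₁ : 0 < c₁) (κ₀ : ℝ) (hκ₀ : κ₀ < 1)
    (n p : ℕ → ℕ) (L : ∀ m, Model q (p m)) (lam : ℕ → ℝ)
    (Ω : ℕ → Type u) (_ : ∀ m, MeasurableSpace (Ω m)) (P : ∀ m, Measure (Ω m))
    (_ : ∀ m, IsProbabilityMeasure (P m))
    (Z : ∀ m, Fin (n m) → Ω m → Fin (q + 1) × EuclideanSpace ℝ (Fin (p m)))
    (hZ : ∀ m, (L m).IsSample (P m) (Z m)) (hD : ∀ m, (L m).D.Nonempty)
    (hLφ : ∀ m, (L m).phi ≤ φ₀) (hLΔ : ∀ m, (L m).Delta ≤ Δ₀) (hLη : ∀ m, (L m).etaStar ≤ η₀)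
    (hs : ∀ m j, (L m).cov j j ≤ s₀) (hκ : ∀ m, (L m).kappa ≤ κ₀)
    (hbal : ∀ m, (L m).Balanced c₁ C₁) (hlam : ∀ m, 0 < lam m)
    (hn : Tendsto n atTop atTop) (hp : Tendsto p atTop atTop)
    (hlow : (fun m => √(((L m).d : ℝ) ^ 2 * Real.log (p m * (L m).d) / n m)) =o[atTop] lam)
    (hup : lam =o[atTop] (fun m => (L m).thetaMin)) :
    ∃ A : ∀ m, Set (Ω m), (∀ m, MeasurableSet (A m)) ∧
      Tendsto (fun m => (P m).real (A m)) atTop (𝓝 1) ∧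
      ∀ m, ∀ ω ∈ A m, Success (fun i => Z m i ω) (L m) (lam m) := by
  set φ := |φ₀|
  set η := |η₀|
  set Δ := |Δ₀|
  have hφ : 0 ≤ φ := abs_nonneg _
  have hη : 0 ≤ η := abs_nonneg _
  have hΔ : 0 ≤ Δ := abs_nonneg _
  have hκ₀' : 0 < 1 - κ₀ := by linarith
  obtain ⟨C, c, hC, hc, h⟩ := Model.exists_event_success.{u} q (s := max s₀ 1)
    (g := c₁ / (2 * ((q + 1 : ℕ) : ℝ))) (le_max_right _ _) (by positivity) one_pos hη hΔ hκ₀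
  set a : ℝ := (1 - κ₀) / (3 * (q + 1) * (1 + η) * (1 + 2 * Δ)) with ha
  have ha0 : 0 < a := by positivity
  have hκ₀1 : 0 ≤ κ₀ := (L 0).kappa_nonneg.trans (hκ 0)
  have ha1 : a ≤ 1 := by
    rw [ha, div_le_one (by positivity)]
    have : (1 : ℝ) * 1 * 1 * 1 ≤ 3 * (q + 1) * (1 + η) * (1 + 2 * Δ) := by
      gcongr <;> linarith [(Nat.cast_nonneg q : (0 : ℝ) ≤ q)]
    linarith
  -- All smallness conditions on `λ` follow from `λ ≤ b θ_min`.
  set b : ℝ := (8 * φ + 24 * q ^ 2 * η * φ / (1 - κ₀) + 2 * φ * Δ + Δ + 1)⁻¹ with hb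
  have hb0 : 0 < b := by positivity
  have hb1 : 8 * φ * b + 24 * q ^ 2 * η * φ / (1 - κ₀) * b + 2 * φ * Δ * b + Δ * b + b = 1 := by
    have : (8 * φ + 24 * q ^ 2 * η * φ / (1 - κ₀) + 2 * φ * Δ + Δ + 1) * b = 1 :=
      mul_inv_cancel₀ (by positivity)
    linarith
  have q1 : 0 ≤ 8 * φ * b := by positivity
  have q2 : 0 ≤ 24 * q ^ 2 * η * φ / (1 - κ₀) * b := by positivity
  have q3 : 0 ≤ 2 * φ * Δ * b := by positivity
  have q4 : 0 ≤ Δ * b := by positivity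
  have hevent : ∀ m, ∃ A : Set (Ω m), MeasurableSet A ∧
      (lam m ≤ b * (L m).thetaMin → (P m).real Aᶜ ≤
        C * p m * (L m).d * Real.exp (-(c * n m * ((a * lam m) ^ 2 / (L m).d ^ 2)))) ∧
      ∀ ω ∈ A, Success (fun i => Z m i ω) (L m) (lam m) := by
    intro m
    by_cases hm : lam m ≤ b * (L m).thetaMin
    · have hφ' : (L m).phi ≤ φ := (hLφ m).trans (le_abs_self _)
      have hη' : (L m).etaStar ≤ η := (hLη m).trans (le_abs_self _)
      have hΔ' : (L m).Delta ≤ Δ := (hLΔ m).trans (le_abs_self _)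
      have hφ0 := (L m).phi_nonneg
      have hη0 := (L m).etaStar_nonneg
      have hl := hlam m
      have hθ0 : 0 < (L m).thetaMin := pos_of_mul_pos_right (hl.trans_le hm) hb0.le
      have hθΔ : (L m).thetaMin ≤ Δ := ((L m).thetaMin_le_Delta (hD m)).trans hΔ'
      have hlΔ : lam m ≤ Δ * b := hm.trans (by rw [mul_comm]; gcongr)
      have hal : a * lam m ≤ lam m := mul_le_of_le_one_left hl.le ha1
      obtain ⟨A, hA, hPA, hAS⟩ := h (n m) (p m) (L m) (a * lam m) (lam m) (Ω m) _ (P m)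
        inferInstance (Z m) (hZ m) (hD m) (fun j => (hs m j).trans (le_max_left _ _))
        (fun k => le_of_eq_of_le (by field_simp) ((hbal m).1 k).1) hΔ' hη' (hκ m)
        (by positivity) (by linarith)
        (by
          calc a * lam m * (L m).phi ≤ Δ * b * φ :=
                mul_le_mul (hal.trans hlΔ) hφ' hφ0 q4
            _ ≤ 1 / 2 := by linarith)
        hl le_rfl
        (by
          have h1 : 4 * (L m).phi * lam m ≤ 4 * φ * (b * (L m).thetaMin) := by gcongr
          have h2 : 8 * φ * b * (L m).thetaMin ≤ 1 * (L m).thetaMin := by gcongr; linarith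
          linarith)
        (by
          have h1 : 24 * (q : ℝ) ^ 2 * (L m).etaStar * (L m).phi * lam m
              ≤ 24 * q ^ 2 * η * φ * (b * (L m).thetaMin) := by gcongr
          have h2 : 24 * (q : ℝ) ^ 2 * η * φ * (b * (L m).thetaMin)
              = (1 - κ₀) * (24 * q ^ 2 * η * φ / (1 - κ₀) * b * (L m).thetaMin) := by
            field_simp
          have h3 : 24 * q ^ 2 * η * φ / (1 - κ₀) * b * (L m).thetaMin
              ≤ 1 * (L m).thetaMin := by gcongr; linarith
          calc _ ≤ _ := h1
            _ = _ := h2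
            _ ≤ (1 - κ₀) * (1 * (L m).thetaMin) := by gcongr
            _ ≤ (1 - (L m).kappa) * (L m).thetaMin := by
                rw [one_mul]; gcongr; exact hκ m)
      exact ⟨A, hA, fun _ => hPA, hAS⟩
    · exact ⟨∅, MeasurableSet.empty, fun h => absurd h hm, fun ω hω => hω.elim⟩
  choose A hA hPA hAS using hevent
  refine ⟨A, hA, ?_, hAS⟩
  -- At this rate the exponential is at most `(p d)⁻²`.
  have hbound : ∀ᶠ m in atTop, 1 - C * (p m : ℝ)⁻¹ ≤ (P m).real (A m) := by
    have hδ : 0 < √(c * a ^ 2 / 2) := Real.sqrt_pos.2 (by positivity)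
    filter_upwards [hup.def hb0, hlow.def hδ, hn.eventually_gt_atTop 0,
      hp.eventually_gt_atTop 0] with m h1 h2 h3 h4
    have hn0 : (0 : ℝ) < n m := by exact_mod_cast h3
    have hp1 : (1 : ℝ) ≤ p m := by exact_mod_cast h4
    have hd1 : (1 : ℝ) ≤ (L m).d := by exact_mod_cast (hD m).card_pos
    have hpd : (1 : ℝ) ≤ p m * (L m).d := one_le_mul_of_one_le_of_one_le hp1 hd1
    rw [Real.norm_of_nonneg (hlam m).le, Real.norm_of_nonneg (L m).thetaMin_nonneg] at h1
    rw [Real.norm_of_nonneg (hlam m).le, Real.norm_of_nonneg (Real.sqrt_nonneg _)] at h2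
    have hlog := Real.log_nonneg hpd
    have h5 : ((L m).d : ℝ) ^ 2 * Real.log (p m * (L m).d) / n m
        ≤ c * a ^ 2 / 2 * lam m ^ 2 := by
      have h6 := pow_le_pow_left₀ (Real.sqrt_nonneg _) h2 2
      rwa [Real.sq_sqrt (by positivity), mul_pow, Real.sq_sqrt (by positivity)] at h6
    have h6 : 2 * Real.log (p m * (L m).d) ≤ c * n m * ((a * lam m) ^ 2 / (L m).d ^ 2) := by
      rw [div_le_iff₀ hn0] at h5
      rw [← mul_div_assoc, le_div_iff₀ (by positivity)]
      linarith
    have h7 : Real.exp (-(c * n m * ((a * lam m) ^ 2 / (L m).d ^ 2)))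
        ≤ ((p m * (L m).d) ^ 2 : ℝ)⁻¹ := by
      rw [Real.exp_neg]
      gcongr
      calc ((p m * (L m).d) ^ 2 : ℝ) = Real.exp (Real.log (p m * (L m).d)) ^ 2 := by
            rw [Real.exp_log (by linarith)]
        _ = Real.exp (2 * Real.log (p m * (L m).d)) := by rw [← Real.exp_nat_mul]; norm_num
        _ ≤ _ := Real.exp_le_exp.2 h6
    have h8 := hPA m h1
    rw [probReal_compl_eq_one_sub (hA m)] at h8
    have h9 : C * p m * (L m).d * Real.exp (-(c * n m * ((a * lam m) ^ 2 / (L m).d ^ 2)))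
        ≤ C * (p m : ℝ)⁻¹ := by
      calc _ ≤ C * p m * (L m).d * ((p m * (L m).d) ^ 2 : ℝ)⁻¹ := by gcongr
        _ = C * ((p m * (L m).d : ℝ))⁻¹ := by field_simp
        _ ≤ _ := by
            gcongr
            exact le_mul_of_one_le_right (by linarith) hd1
    linarith
  have hlim : Tendsto (fun m => 1 - C * (p m : ℝ)⁻¹) atTop (𝓝 1) := by
    have := ((tendsto_inv_atTop_zero.comp
      (tendsto_natCast_atTop_atTop (R := ℝ).comp hp)).const_mul C).const_sub 1
    simpa using this
  exact tendsto_of_tendsto_of_tendsto_of_le_of_le' hlim tendsto_const_nhds hbound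
    (Eventually.of_forall fun m => measureReal_le_one)

end MSDA

theorem theorem1 (K q : ℕ) (hK : K = q + 1) (hq : 1 ≤ q)
    (c₁ C₁ φ₀ Δ₀ η₀ s₀ : ℝ) (hc₁ : 0 < c₁) :
    -- Part 1
    (∀ θ₀ : ℝ, 0 < θ₀ → ∃ M : ℝ, 0 < M ∧ ∀ κ₀ : ℝ, κ₀ < 1 → ∃ C c : ℝ, 0 < C ∧ 0 < c ∧
      ∀ (n p : ℕ) (L : MSDA.Model q p) (lam ε : ℝ)
        (Ω : Type*) (_ : MeasurableSpace Ω) (P : Measure Ω) (_ : IsProbabilityMeasure P)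
        (Z : Fin n → Ω → Fin (q + 1) × EuclideanSpace ℝ (Fin p)),
        L.IsSample P Z → L.D.Nonempty →
        L.phi ≤ φ₀ → L.Delta ≤ Δ₀ → L.etaStar ≤ η₀ → (∀ j, L.cov j j ≤ s₀) →
        θ₀ ≤ L.thetaMin → L.kappa ≤ κ₀ → L.Balanced c₁ C₁ →
        lam < min (L.thetaMin / (8 * L.phi)) (M * (1 - L.kappa)) →
        0 < ε → ε < min (1 / (2 * L.phi)) (lam / (1 + L.phi * L.Delta)) →
        ∃ A : Set Ω, MeasurableSet A ∧
          1 - C * p * L.d * Real.exp (-(c * n * (ε ^ 2 / (K * L.d ^ 2))))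
            - C * K * Real.exp (-(c * (n / K ^ 2)))
            - C * p * (K - 1) * Real.exp (-(c * n * (ε ^ 2 / K))) < P.real A ∧
          ∀ ω ∈ A, MSDA.Success (fun i => Z i ω) L lam) ∧
    -- Part 2
    (∀ κ₀ : ℝ, κ₀ < 1 →
      ∀ (n p : ℕ → ℕ) (L : ∀ m, MSDA.Model q (p m)) (lam : ℕ → ℝ)
        (Ω : ℕ → Type*) (_ : ∀ m, MeasurableSpace (Ω m)) (P : ∀ m, Measure (Ω m))
        (_ : ∀ m, IsProbabilityMeasure (P m))
        (Z : ∀ m, Fin (n m) → Ω m → Fin (q + 1) × EuclideanSpace ℝ (Fin (p m))),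
        (∀ m, (L m).IsSample (P m) (Z m)) → (∀ m, (L m).D.Nonempty) →
        (∀ m, (L m).phi ≤ φ₀) → (∀ m, (L m).Delta ≤ Δ₀) → (∀ m, (L m).etaStar ≤ η₀) →
        (∀ m j, (L m).cov j j ≤ s₀) → (∀ m, (L m).kappa ≤ κ₀) →
        (∀ m, (L m).Balanced c₁ C₁) → (∀ m, 0 < lam m) →
        Tendsto n atTop atTop → Tendsto p atTop atTop →
        Tendsto (fun m => ((L m).d : ℝ) ^ 2 * Real.log (p m * (L m).d) / n m) atTop (𝓝 0) →
        (fun m => √(((L m).d : ℝ) ^ 2 * Real.log (p m * (L m).d) / n m))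
          =o[atTop] (fun m => (L m).thetaMin) →
        (fun m => √(((L m).d : ℝ) ^ 2 * Real.log (p m * (L m).d) / n m)) =o[atTop] lam →
        lam =o[atTop] (fun m => (L m).thetaMin) →
        ∃ A : ∀ m, Set (Ω m), (∀ m, MeasurableSet (A m)) ∧
          Tendsto (fun m => (P m).real (A m)) atTop (𝓝 1) ∧
          ∀ m, ∀ ω ∈ A m, MSDA.Success (fun i => Z m i ω) (L m) (lam m)) := by
  subst hK
  exact ⟨fun θ₀ hθ₀ => MSDA.nonasymptotic_recovery hc₁ θ₀ hθ₀,
    fun κ₀ hκ₀ n p L lam Ω mΩ P hP Z hZ hD hφ hΔ hη hs hκ hbal hlam hn hp _ _ hlow hup =>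
      MSDA.asymptotic_recovery hc₁ κ₀ hκ₀ n p L lam Ω mΩ P hP Z hZ hD hφ hΔ hη hs hκ hbal hlam
        hn hp hlow hup⟩
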